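/- For integers $0\le n\le u$ write $\mathcal B(n,u)=\lceil \log_2\binom{u}{n}\rceil$ and $[m]=\{0,\dots,m-1\}$. The computation model is the word RAM with word size $w$ bits, where only $m+n<2^w$ is assumed (so in particular $w=\Theta(\lg(m+n))$ is allowed): a data structure is a string of bits, stored in read-only memory in consecutive $w$-bit words; a query algorithm is a fixed program, independent of $n,m,w$ and of the data, which starts with $n$, $m$, $w$ and the query argument in registers and performs in unit time: arithmetic modulo $2^w$ (addition, subtraction, multiplication), integer division, bitwise logic, shifts, most significant bit, comparisons with jumps, loading of constants, copying of registers, and reading of a memory word. 1. (Prefix sums.) There are a program, a constant $T$ and a function $g(n)=o(n)$ such that for all integers $n,m\ge 0$ and every $w$ with $m+n<2^w$, every sequence $X=x_1,\dots,x_n$ of non-negative integers with $\sum_{j=1}^n x_j\le m$ (in particular every such sequence of sum exactly $m$) can be represented by a string of at most $\mathcal B(n,m+n)+g(n)$ bits (its length depending only on $n$, $m$, $w$) from which the program answers every query $\mathrm{Sum}(i,X)=\sum_{j=1}^i x_j$, $1\le i\le n$, in at most $T$ steps. 2. (Multisets.) Likewise there are a program, a constant $T$ and a function $g(n)=o(n)$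 such that for all $n,m\ge 0$ and every $w$ with $m+n<2^w$, every multiset $M$ of $n$ elements (counted with multiplicity) from $[m]$ can be represented by a string of at most $\mathcal B(n,m+n)+g(n)$ bits (its length depending only on $n$, $m$, $w$) from which the program answers every query $\mathrm{Selectm}(i,M)$, $1\le i\le n$, in at most $T$ steps. Here $\mathrm{Selectm}(i,M)$ is the largest $x\in M$ with $\mathrm{Rankm}(x,M)\le i-1$, where $\mathrm{Rankm}(x,M)=|\{y\in M: y<x\}|$ (with multiplicity) for $x\in M$ and $\mathrm{Rankm}(x,M)=-1$ for $x\notin M$. 3. (Optimality.) For all $n,m\ge 0$, $\mathcal B(n,m+n)$ is the information-theoretic minimum for the sequences in 1: it is the least $L$ such that the sequences of $n$ non-negative integers with sum at most $m$ can be mapped injectively to strings of $L$ bits. Moreover, if the multisets of $n$ elements from $[m]$ can be mapped injectively to strings of $L$ bits, then $L\ge \mathcal B(n,m+n)-\lceil\log_2(n+1)\rceil$, so that the space bound in 2 is within $o(n)$ bits of optimal; and if $n\ge 1$ and the sequences of $n$ non-negative integers with sum exactly $m$ can be mapped injectively to strings of $L$ bits, then $L\ge \mathcal B(n,m+n)-\lceil\log_2\frac{m+n}{n}\rceil$.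 -/

import Mathlib

namespace Succinct

/-! ### The word RAM

A machine with word size `w`: registers hold words, i.e. naturals below `2 ^ w`, and the static data
structure is a read-only memory of `w`-bit words, addressed by words. Every instruction costs one
step. A program is a fixed finite list of instructions, independent of `w` and of the input. -/

/-- Two-operand word instructions: arithmetic modulo `2 ^ w`, integer division, bitwise logic and
shifts by a variable amount. -/
inductive BinOp
  | add | sub | mul | div | and | or | xor | shl | shr

/-- The effect of a two-operand instruction on words `x, y < 2 ^ w` (with `x / 0 = 0`). -/
def BinOp.eval (w : ℕ) : BinOp → ℕ → ℕ → ℕ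
  | .add, x, y => (x + y) % 2 ^ w
  | .sub, x, y => (x + (2 ^ w - y)) % 2 ^ w
  | .mul, x, y => (x * y) % 2 ^ w
  | .div, x, y => x / y
  | .and, x, y => x &&& y
  | .or, x, y => x ||| y
  | .xor, x, y => x ^^^ y
  | .shl, x, y => (x * 2 ^ y) % 2 ^ w
  | .shr, x, y => x / 2 ^ y

/-- Instructions. Registers and jump targets are natural numbers; `d` is the destination register.
`msb` is the index of the most significant set bit, `⌊lg x⌋` (and `0` for `x = 0`), which the word
RAM literature evaluates in constant time. -/
inductive Instr
  /-- `R[d] := k mod 2 ^ w` -/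
  | const (d k : ℕ)
  /-- `R[d] := R[a]` -/
  | move (d a : ℕ)
  /-- `R[d] := R[a] op R[b]` -/
  | bin (op : BinOp) (d a b : ℕ)
  /-- `R[d] := ⌊lg R[a]⌋` -/
  | msb (d a : ℕ)
  /-- `R[d] := MEM[R[a]]` -/
  | load (d a : ℕ)
  /-- if `R[a] < R[b]` go to instruction `t` -/
  | jlt (a b t : ℕ)
  /-- if `R[a] = R[b]` go to instruction `t` -/
  | jeq (a b t : ℕ)
  /-- stop -/
  | halt

/-- A program; execution starts at instruction `0`. -/
abbrev Program := List Instr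

/-- A configuration: program counter and register contents. -/
structure Config where
  pc : ℕ
  reg : ℕ → ℕ

/-- Write `v` to register `d` and go on to the next instruction. -/
def Config.write (c : Config) (d v : ℕ) : Config :=
  ⟨c.pc + 1, Function.update c.reg d v⟩

/-- Go to instruction `t` if `p` holds, and to the next instruction otherwise. -/
def Config.jump (c : Config) (p : Prop) [Decidable p] (t : ℕ) : Config :=
  ⟨if p then t else c.pc + 1, c.reg⟩

/-- The effect of one instruction on a machine with word size `w` and memory `mem`. -/
def Instr.exec (w : ℕ) (mem : ℕ → ℕ) (c : Config) : Instr → Config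
  | .const d k => c.write d (k % 2 ^ w)
  | .move d a => c.write d (c.reg a)
  | .bin op d a b => c.write d (op.eval w (c.reg a) (c.reg b))
  | .msb d a => c.write d (Nat.log 2 (c.reg a))
  | .load d a => c.write d (mem (c.reg a))
  | .jlt a b t => c.jump (c.reg a < c.reg b) t
  | .jeq a b t => c.jump (c.reg a = c.reg b) t
  | .halt => c

/-- The instruction to be executed next; leaving the program means `halt`. -/
def Program.fetch (P : Program) (c : Config) : Instr := P.getD c.pc .halt

/-- One step. A halted configuration is left unchanged. -/
def Program.step (P : Program) (w : ℕ) (mem : ℕ → ℕ) (c : Config) : Config :=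
  (P.fetch c).exec w mem c

/-- `S` bits stored in consecutive words of `w` bits, the last one padded with zeros: word number
`a` holds the bits at positions `a * w, …, a * w + w - 1` (and is `0` past the end). -/
def memory (w : ℕ) {S : ℕ} (bits : BitVec S) (a : ℕ) : ℕ :=
  bits.toNat / 2 ^ (a * w) % 2 ^ w

/-- The initial configuration of a query with argument `i`: registers `0, 1, 2, 3` hold
`n, m, w, i` and all the others hold `0`. -/
def initConfig (n m w i : ℕ) : Config :=
  ⟨0, fun r => match r with
    | 0 => n
    | 1 => m
    | 2 => w
    | 3 => i
    | _ => 0⟩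

/-- On the machine with word size `w` whose memory holds `bits`, for the parameters `n` and `m` and
the query argument `i`, the program `P` halts within `T` steps with `v` in register `0`. -/
def Answers (P : Program) (T n m w : ℕ) {S : ℕ} (bits : BitVec S) (i v : ℕ) : Prop :=
  let c := (P.step w (memory w bits))^[T] (initConfig n m w i)
  P.fetch c = .halt ∧ c.reg 0 = v

/-! ### Space bounds -/

/-- `B(n, m) = ⌈lg (m choose n)⌉`. -/
noncomputable def B (n m : ℕ) : ℕ := ⌈Real.logb 2 (m.choose n : ℝ)⌉₊

/-- The members of `α` can be represented, in whatever way, by strings of `L` bits. -/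
def EncodableInBits (α : Type) (L : ℕ) : Prop :=
  ∃ f : α → BitVec L, Function.Injective f

/-! ### The queries -/

/-- `Sum(i, X) = x₁ + ⋯ + xᵢ`, where the entry `x j` of `x : Fin n → ℕ` is `x_{j+1}`. -/
def prefixSum {n : ℕ} (x : Fin n → ℕ) (i : ℕ) : ℕ :=
  ∑ j : Fin n with j.val < i, x j

/-- Multiset rank: `-1` if `x ∉ M`, and the number of `y ∈ M`, counted with multiplicity, such that
`y < x` otherwise. -/
def rankm {m : ℕ} (x : Fin m) (M : Multiset (Fin m)) : ℤ :=
  if x ∈ M then (M.countP (· < x) : ℤ) else -1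

/-- `v` is the answer of multiset select at `i`: the largest `x ∈ M` of multiset rank at most
`i - 1`. -/
def IsSelectm {m : ℕ} (i : ℕ) (M : Multiset (Fin m)) (v : Fin m) : Prop :=
  IsGreatest {x : Fin m | x ∈ M ∧ rankm x M ≤ (i : ℤ) - 1} v

end Succinct

/-!
Only the monotone sequence `H` of prefix sums, or of the sorted multiset, matters. Its `lowBits n m`
low bits are stored verbatim. This costs only `o(n)` bits, since `K + 1` choices for each increment
in place of `K` change the count by a factor of at most `2 ^ (2 * (n / K + 1))`, and the remaining
high parts grow on average by at least `K = 2 ^ logLog n`, which is of the order of `lg n`.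

The increments of the high parts are divided into blocks of `(lg lg n)²`. A block with sum `y` is
coded by the number of a sequence with sum at most `y`. By Vandermonde's inequality the product of
the numbers of such sequences is at most the number of sequences for all of `H`, so the lengths of
the codes add up to `B n (m + n)` and one bit of rounding per block. A code is so much shorter than
`lg n` that a table decodes it in constant time. The sums and the positions of the codes are
recorded relative to superblocks of about `lg n` blocks, in fields of `O(lg lg n)` bits. Superblocks
with a sum too large for such fields are rare, because the high parts are small, and store their
values explicitly. For large `n` the table has fewer than `n` bits even after multiplication by a
fixed power of `lg n`, and every other part of the overhead is `O(n / lg lg n)`.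

The query is a branch-free expression: a case distinction is the combination `c * a + (1 - c) * b`.
-/

namespace Succinct

/-! ### Bit fields -/

/-- The number written in the `f` binary digits of `X` from position `p` on. -/
def bitField (X p f : ℕ) : ℕ := X / 2 ^ p % 2 ^ f

theorem bitField_lt (X p f : ℕ) : bitField X p f < 2 ^ f := Nat.mod_lt _ (by positivity)

theorem bitField_mod_two_pow {X p f w : ℕ} (h : bitField X p f < 2 ^ w) :
    bitField X p w % 2 ^ f = bitField X p f := by
  rcases le_total f w with hfw | hwf
  · exact Nat.mod_mod_of_dvd _ (pow_dvd_pow 2 hfw)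
  · have hw : bitField X p w = bitField X p f := by
      rw [← Nat.mod_eq_of_lt h, bitField, bitField, Nat.mod_mod_of_dvd _ (pow_dvd_pow 2 hwf)]
    rw [hw, Nat.mod_eq_of_lt (bitField_lt ..)]

theorem bitField_adjacent (X A : ℕ) {w r : ℕ} (hr : r ≤ w) :
    bitField X (A * w) w / 2 ^ r + bitField X ((A + 1) * w) w * 2 ^ (w - r) % 2 ^ w =
      bitField X (A * w + r) w := by
  obtain ⟨s, rfl⟩ := Nat.exists_eq_add_of_le hr
  generalize hY : X / 2 ^ (A * (r + s)) = Y
  have hsplit : (2 : ℕ) ^ (r + s) = 2 ^ s * 2 ^ r := by rw [pow_add, mul_comm]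
  have hlow : Y % 2 ^ (r + s) / 2 ^ r = Y / 2 ^ r % 2 ^ s := by
    rw [pow_add, Nat.mod_mul_right_div_self]
  have hhigh : Y / 2 ^ (r + s) % 2 ^ (r + s) * 2 ^ s % 2 ^ (r + s) =
      2 ^ s * (Y / 2 ^ r / 2 ^ s % 2 ^ r) := by
    rw [Nat.div_div_eq_div_mul, ← pow_add, Nat.mod_mul_mod, mul_comm _ (2 ^ s), hsplit,
      Nat.mul_mod_mul_left]
  simp only [bitField, Nat.add_sub_cancel_left, add_mul, one_mul, pow_add _ (A * (r + s)),
    ← Nat.div_div_eq_div_mul, hY]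
  rw [hlow, hhigh, hsplit, Nat.mod_mul]

/-! ### Expressions evaluated by the machine -/

/-- A straight-line computation: an expression over the four input registers. -/
inductive Expr
  | inp (r : Fin 4)
  | const (k : ℕ)
  | bin (op : BinOp) (a b : Expr)
  | msb (a : Expr)
  | load (a : Expr)

/-- What the value of an expression depends on: word size, memory and input registers. -/
structure State where
  wordSize : ℕ
  mem : ℕ → ℕ
  input : Fin 4 → ℕ

/-- The memory holds the binary digits of `X`, and register `2` the word size. -/
structure State.Holds (σ : State) (X : ℕ) : Prop where
  mem_eq : ∀ k, σ.mem k = bitField X (k * σ.wordSize) σ.wordSize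
  input_two : σ.input 2 = σ.wordSize

/-- The state of a query with argument `i` to a structure stored as `bits`. -/
def queryState (n m w : ℕ) {S : ℕ} (bits : BitVec S) (i : ℕ) : State :=
  ⟨w, memory w bits, ![n, m, w, i]⟩

theorem queryState_holds (n m w : ℕ) {S : ℕ} (bits : BitVec S) (i : ℕ) :
    (queryState n m w bits i).Holds bits.toNat :=
  ⟨fun _ => rfl, rfl⟩

namespace Expr

instance (k : ℕ) : OfNat Expr k := ⟨.const k⟩
instance : Add Expr := ⟨.bin .add⟩
instance : Sub Expr := ⟨.bin .sub⟩
instance : Mul Expr := ⟨.bin .mul⟩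
instance : Div Expr := ⟨.bin .div⟩
instance : Mod Expr := ⟨fun a b => a - a / b * b⟩
instance : ShiftLeft Expr := ⟨.bin .shl⟩
instance : ShiftRight Expr := ⟨.bin .shr⟩

/-- The value of an expression, with word arithmetic. -/
def eval (σ : State) : Expr → ℕ
  | .inp r => σ.input r
  | .const k => k % 2 ^ σ.wordSize
  | .bin op a b => op.eval σ.wordSize (a.eval σ) (b.eval σ)
  | .msb a => Nat.log 2 (a.eval σ)
  | .load a => σ.mem (a.eval σ)

/-- Code that leaves the value of the expression in register `d` and changes no register below. -/
def code : ℕ → Expr → Program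
  | d, .inp r => [.move d r]
  | d, .const k => [.const d k]
  | d, .bin op a b => a.code d ++ (b.code (d + 1) ++ [.bin op d d (d + 1)])
  | d, .msb a => a.code d ++ [.msb d d]
  | d, .load a => a.code d ++ [.load d d]

/-- The program that computes the expression above the input registers and returns its value. -/
def program (e : Expr) : Program := e.code 4 ++ [.move 0 4]

end Expr

/-- Wherever the jump-free `code` stands in a program, running through it turns the register
contents `reg` into `reg'`. -/
def Executes (σ : State) (code : Program) (reg reg' : ℕ → ℕ) : Prop :=
  ∀ pre post : Program,
    (Program.step (pre ++ (code ++ post)) σ.wordSize σ.mem)^[code.length] ⟨pre.length, reg⟩ =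
      ⟨pre.length + code.length, reg'⟩

theorem Executes.append {σ : State} {code₁ code₂ : Program} {reg₁ reg₂ reg₃ : ℕ → ℕ}
    (h₁ : Executes σ code₁ reg₁ reg₂) (h₂ : Executes σ code₂ reg₂ reg₃) :
    Executes σ (code₁ ++ code₂) reg₁ reg₃ := by
  intro pre post
  have h₁ := h₁ pre (code₂ ++ post)
  have h₂ := h₂ (pre ++ code₁) post
  simp only [List.append_assoc, List.length_append] at h₁ h₂ ⊢
  rw [add_comm code₁.length, Function.iterate_add_apply, h₁, h₂, add_assoc, add_comm code₁.length]

theorem executes_singleton {σ : State} {instr : Instr} {reg reg' : ℕ → ℕ}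
    (h : ∀ pc, instr.exec σ.wordSize σ.mem ⟨pc, reg⟩ = ⟨pc + 1, reg'⟩) :
    Executes σ [instr] reg reg' := by
  intro pre post
  have hfetch : Program.fetch (pre ++ ([instr] ++ post)) ⟨pre.length, reg⟩ = instr := by
    simp [Program.fetch]
  rw [List.length_singleton, Function.iterate_one, Program.step, hfetch, h]

namespace Expr

theorem exists_executes_code {σ : State} (e : Expr) (d : ℕ) (reg : ℕ → ℕ) (hd : 4 ≤ d)
    (hreg : ∀ r : Fin 4, reg r = σ.input r) :
    ∃ reg', Executes σ (e.code d) reg reg' ∧ reg' d = e.eval σ ∧ ∀ r < d, reg' r = reg r := by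
  induction e generalizing d reg with
  | inp r =>
    exact ⟨Function.update reg d (reg r), executes_singleton fun _ => rfl,
      by simp [eval, hreg], fun q hq => Function.update_of_ne hq.ne _ _⟩
  | const k =>
    exact ⟨Function.update reg d (k % 2 ^ σ.wordSize), executes_singleton fun _ => rfl,
      by simp [eval], fun q hq => Function.update_of_ne hq.ne _ _⟩
  | bin op a b iha ihb =>
    obtain ⟨reg₁, exec₁, val₁, keep₁⟩ := iha d reg hd hreg
    obtain ⟨reg₂, exec₂, val₂, keep₂⟩ := ihb (d + 1) reg₁ (by lia)
      fun r => (keep₁ r (by lia)).trans (hreg r)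
    refine ⟨Function.update reg₂ d (op.eval σ.wordSize (reg₂ d) (reg₂ (d + 1))),
      exec₁.append (exec₂.append (executes_singleton fun _ => rfl)), ?_, fun q hq => ?_⟩
    · rw [Function.update_self, val₂, keep₂ d (by lia), val₁, eval]
    · rw [Function.update_of_ne hq.ne, keep₂ q (by lia), keep₁ q hq]
  | msb a iha =>
    obtain ⟨reg₁, exec₁, val₁, keep₁⟩ := iha d reg hd hreg
    refine ⟨Function.update reg₁ d (Nat.log 2 (reg₁ d)),
      exec₁.append (executes_singleton fun _ => rfl), ?_, fun q hq => ?_⟩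
    · rw [Function.update_self, val₁, eval]
    · rw [Function.update_of_ne hq.ne, keep₁ q hq]
  | load a iha =>
    obtain ⟨reg₁, exec₁, val₁, keep₁⟩ := iha d reg hd hreg
    refine ⟨Function.update reg₁ d (σ.mem (reg₁ d)),
      exec₁.append (executes_singleton fun _ => rfl), ?_, fun q hq => ?_⟩
    · rw [Function.update_self, val₁, eval]
    · rw [Function.update_of_ne hq.ne, keep₁ q hq]

theorem program_answers (e : Expr) (n m w : ℕ) {S : ℕ} (bits : BitVec S) (i : ℕ) :
    Answers e.program e.program.length n m w bits i (e.eval (queryState n m w bits i)) := by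
  obtain ⟨reg, exec, val, -⟩ := e.exists_executes_code (σ := queryState n m w bits i) 4
    (initConfig n m w i).reg le_rfl (by intro r; fin_cases r <;> rfl)
  have exec' : Executes (queryState n m w bits i) e.program (initConfig n m w i).reg
      (Function.update reg 0 (reg 4)) :=
    exec.append (executes_singleton fun _ => rfl)
  have hrun : (Program.step e.program w (memory w bits))^[e.program.length]
      (initConfig n m w i) = ⟨e.program.length, Function.update reg 0 (reg 4)⟩ := by
    have h := exec' [] []
    rwa [List.append_nil, List.nil_append, List.length_nil, zero_add] at h
  simp only [Answers, hrun]
  exact ⟨by simp [Program.fetch], by simp [val]⟩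

/-- In the state `σ` the expression has the value `v`. -/
def HasValue (σ : State) (e : Expr) (v : ℕ) : Prop := e.eval σ = v

/-- The lowest `f` bits of `a`. -/
def low (a f : Expr) : Expr := a - a >>> f <<< f

/-- The `w` bits of memory that start `r` bits after the beginning of word `a`, for `r < w`. -/
def window (a r : Expr) : Expr :=
  a.load >>> r + (a + 1).load <<< (inp 2 - r)

/-- The field of `f` bits of memory that starts `r` bits after the beginning of word `a`. -/
def field (a r f : Expr) : Expr :=
  (window (a + r / inp 2) (r % inp 2)).low f

/-- `a` if `c` is `1`, and `b` if `c` is `0`. -/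
def select (c a b : Expr) : Expr := c * a + (1 - c) * b

namespace HasValue

variable {σ : State} {a b c : Expr} {x y : ℕ}

theorem const {k : ℕ} (hk : k < 2 ^ σ.wordSize) : (Expr.const k).HasValue σ k :=
  Nat.mod_eq_of_lt hk

theorem add (ha : a.HasValue σ x) (hb : b.HasValue σ y) (h : x + y < 2 ^ σ.wordSize) :
    (a + b).HasValue σ (x + y) := by
  cases ha; cases hb
  exact Nat.mod_eq_of_lt h

theorem sub (ha : a.HasValue σ x) (hb : b.HasValue σ y) (h : y ≤ x) (hx : x < 2 ^ σ.wordSize) :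
    (a - b).HasValue σ (x - y) := by
  cases ha; cases hb
  change (_ + (_ - _)) % _ = _
  rw [← Nat.add_sub_assoc (h.trans hx.le), Nat.sub_add_comm h, Nat.add_mod_right,
    Nat.mod_eq_of_lt (by lia)]

theorem mul (ha : a.HasValue σ x) (hb : b.HasValue σ y) (h : x * y < 2 ^ σ.wordSize) :
    (a * b).HasValue σ (x * y) := by
  cases ha; cases hb
  exact Nat.mod_eq_of_lt h

theorem zero_mul (ha : a.HasValue σ 0) (b : Expr) : (a * b).HasValue σ 0 := by
  change (_ * _) % _ = _
  rw [ha, Nat.zero_mul, Nat.zero_mod]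

theorem div (ha : a.HasValue σ x) (hb : b.HasValue σ y) : (a / b).HasValue σ (x / y) := by
  cases ha; cases hb
  rfl

theorem shiftLeft (ha : a.HasValue σ x) (hb : b.HasValue σ y)
    (h : x * 2 ^ y < 2 ^ σ.wordSize) : (a <<< b).HasValue σ (x * 2 ^ y) := by
  cases ha; cases hb
  exact Nat.mod_eq_of_lt h

theorem shiftRight (ha : a.HasValue σ x) (hb : b.HasValue σ y) :
    (a >>> b).HasValue σ (x / 2 ^ y) := by
  cases ha; cases hb
  rfl

theorem msb (ha : a.HasValue σ x) : a.msb.HasValue σ (Nat.log 2 x) := by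
  cases ha
  rfl

theorem load (ha : a.HasValue σ x) : a.load.HasValue σ (σ.mem x) := by
  cases ha
  rfl

theorem mod (ha : a.HasValue σ x) (hb : b.HasValue σ y) (hx : x < 2 ^ σ.wordSize) :
    (a % b).HasValue σ (x % y) := by
  have h := Nat.div_mul_le_self x y
  have := ha.sub ((ha.div hb).mul hb (h.trans_lt hx)) h hx
  rwa [mul_comm, ← Nat.mod_eq_sub_mul_div] at this

theorem low (ha : a.HasValue σ x) (hb : b.HasValue σ y) (hx : x < 2 ^ σ.wordSize) :
    (a.low b).HasValue σ (x % 2 ^ y) := by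
  have h := Nat.div_mul_le_self x (2 ^ y)
  have := ha.sub ((ha.shiftRight hb).shiftLeft hb (h.trans_lt hx)) h hx
  rwa [mul_comm, ← Nat.mod_eq_sub_mul_div] at this

theorem select_one (hc : c.HasValue σ 1) (ha : a.HasValue σ x) (hw : 0 < σ.wordSize)
    (hx : x < 2 ^ σ.wordSize) : (select c a b).HasValue σ x := by
  have h1 := Nat.one_lt_two_pow hw.ne'
  have h := (hc.mul ha (by simpa)).add (((const h1).sub hc le_rfl h1).zero_mul b) (by simpa)
  rwa [one_mul, add_zero] at h

theorem select_zero (hc : c.HasValue σ 0) (hb : b.HasValue σ x) (hw : 0 < σ.wordSize)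
    (hx : x < 2 ^ σ.wordSize) : (select c a b).HasValue σ x := by
  have h1 := Nat.one_lt_two_pow hw.ne'
  have h := (hc.zero_mul a).add (((const h1).sub hc zero_le_one h1).mul hb (by simpa)) (by simpa)
  rwa [zero_add, Nat.sub_zero, one_mul] at h

/-- Past a word boundary, the second of two adjacent words supplies the missing bits. -/
theorem window {X A r : ℕ} (hX : σ.Holds X) (ha : a.HasValue σ A) (hb : b.HasValue σ r)
    (hr : r < σ.wordSize) (hA : A + 1 < 2 ^ σ.wordSize) :
    (window a b).HasValue σ (bitField X (A * σ.wordSize + r) σ.wordSize) := by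
  have hw : (inp 2).HasValue σ σ.wordSize := hX.input_two
  have hnext := (ha.add (const (k := 1) (by lia)) hA).load
  have hshift : ((a + 1).load <<< (inp 2 - b)).HasValue σ
      (σ.mem (A + 1) * 2 ^ (σ.wordSize - r) % 2 ^ σ.wordSize) :=
    hnext ▸ hw.sub hb hr.le Nat.lt_two_pow_self ▸ rfl
  have hjoin := bitField_adjacent X A hr.le
  rw [← hX.mem_eq, ← hX.mem_eq] at hjoin
  exact hjoin ▸ (ha.load.shiftRight hb).add hshift (hjoin ▸ bitField_lt ..)

theorem field {r f : Expr} {X A R F : ℕ} (hX : σ.Holds X) (ha : a.HasValue σ A)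
    (hr : r.HasValue σ R) (hf : f.HasValue σ F) (hR : R < 2 ^ σ.wordSize)
    (hA : A + R / σ.wordSize + 1 < 2 ^ σ.wordSize)
    (hv : bitField X (A * σ.wordSize + R) F < 2 ^ σ.wordSize) :
    (a.field r f).HasValue σ (bitField X (A * σ.wordSize + R) F) := by
  have hw0 : 0 < σ.wordSize := Nat.pos_of_ne_zero fun h => by simp [h] at hA
  have hw : (inp 2).HasValue σ σ.wordSize := hX.input_two
  have hwin := window hX (ha.add (hr.div hw) (by lia)) (hr.mod hw hR) (Nat.mod_lt _ hw0) hA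
  rw [add_mul, add_assoc, Nat.div_add_mod'] at hwin
  rw [← bitField_mod_two_pow hv]
  exact hwin.low hf (bitField_lt ..)

end HasValue

end Expr

/-! ### The information-theoretic bounds -/

/-- A bounded sum is an exact sum with one more summand. -/
def boundedSumEquiv (n m : ℕ) :
    {x : Fin n → ℕ // ∑ j, x j ≤ m} ≃ {x : Fin (n + 1) → ℕ // ∑ j, x j = m} where
  toFun x := ⟨Fin.cons (m - ∑ j, x.1 j) x.1, by
    have := x.2
    rw [Fin.sum_cons]
    lia⟩
  invFun x := ⟨Fin.tail x.1, by
    have := x.2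
    rw [Fin.sum_univ_succ] at this
    simp only [Fin.tail]
    lia⟩
  left_inv x := by simp
  right_inv x := by
    have := x.2
    rw [Fin.sum_univ_succ] at this
    apply Subtype.ext
    have h : m - ∑ j, Fin.tail x.1 j = x.1 0 := by
      simp only [Fin.tail]
      lia
    simp only [h, Fin.cons_self_tail]

instance (n m : ℕ) : Finite {x : Fin n → ℕ // ∑ j, x j = m} :=
  Finite.of_equiv _ (Sym.equivNatSumOfFintype (Fin n) m)

instance (n m : ℕ) : Finite {x : Fin n → ℕ // ∑ j, x j ≤ m} :=
  Finite.of_equiv _ (boundedSumEquiv n m).symm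

theorem card_exact_sum (n m : ℕ) :
    Nat.card {x : Fin n → ℕ // ∑ j, x j = m} = (n + m - 1).choose m := by
  rw [← Nat.card_congr (Sym.equivNatSumOfFintype (Fin n) m), Nat.card_eq_fintype_card,
    Sym.card_sym_eq_choose, Fintype.card_fin]

theorem card_bounded_sum (n m : ℕ) :
    Nat.card {x : Fin n → ℕ // ∑ j, x j ≤ m} = (m + n).choose n := by
  rw [Nat.card_congr (boundedSumEquiv n m), card_exact_sum, show n + 1 + m - 1 = m + n by lia,
    Nat.choose_symm_add]

theorem encodableInBits_iff {α : Type} [Finite α] {L : ℕ} :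
    EncodableInBits α L ↔ Nat.card α ≤ 2 ^ L := by
  have e : BitVec L ≃ Fin (2 ^ L) := ⟨BitVec.toFin, BitVec.ofFin, fun _ => rfl, fun _ => rfl⟩
  have := Fintype.ofFinite α
  rw [Nat.card_eq_fintype_card]
  constructor
  · rintro ⟨f, hf⟩
    simpa using Fintype.card_le_of_injective _ (e.injective.comp hf)
  · intro h
    obtain ⟨f⟩ := Function.Embedding.nonempty_of_card_le (α := α) (β := Fin (2 ^ L)) (by simpa)
    exact ⟨e.symm ∘ f, e.symm.injective.comp f.injective⟩

theorem le_two_pow_ceil_logb {x : ℝ} (hx : 0 < x) : x ≤ 2 ^ ⌈Real.logb 2 x⌉₊ := by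
  have h := Nat.le_ceil (Real.logb 2 x)
  rwa [Real.logb_le_iff_le_rpow one_lt_two hx, Real.rpow_natCast] at h

theorem B_le_iff {n u L : ℕ} (h : n ≤ u) : B n u ≤ L ↔ u.choose n ≤ 2 ^ L := by
  have hc : (0 : ℝ) < u.choose n := by exact_mod_cast Nat.choose_pos h
  rw [B, Nat.ceil_le, Real.logb_le_iff_le_rpow one_lt_two hc, Real.rpow_natCast]
  exact_mod_cast Iff.rfl

theorem choose_le_two_pow_B {n u : ℕ} (h : n ≤ u) : u.choose n ≤ 2 ^ B n u :=
  (B_le_iff h).1 le_rfl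

theorem isLeast_encodable_bounded_sum (n m : ℕ) :
    IsLeast {L : ℕ | EncodableInBits {x : Fin n → ℕ // ∑ j, x j ≤ m} L} (B n (m + n)) := by
  constructor
  · rw [Set.mem_ofPred_eq, encodableInBits_iff, card_bounded_sum]
    exact choose_le_two_pow_B (by lia)
  · intro L hL
    rw [Set.mem_ofPred_eq, encodableInBits_iff, card_bounded_sum] at hL
    exact (B_le_iff (by lia)).2 hL

theorem B_le_add_ceil_logb {n u L N : ℕ} {x : ℝ} (hnu : n ≤ u) (hN : N ≤ 2 ^ L)
    (hx : (u.choose n : ℝ) ≤ N * x) : B n u ≤ L + ⌈Real.logb 2 x⌉₊ := by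
  have hpos : (0 : ℝ) < u.choose n := by exact_mod_cast Nat.choose_pos hnu
  have hx0 : 0 < x := pos_of_mul_pos_right (hpos.trans_le hx) N.cast_nonneg
  have hN' : (N : ℝ) ≤ 2 ^ L := by exact_mod_cast hN
  have h : (u.choose n : ℝ) ≤ 2 ^ (L + ⌈Real.logb 2 x⌉₊) := by
    rw [pow_add]
    exact hx.trans (by gcongr; exact le_two_pow_ceil_logb hx0)
  rw [B_le_iff hnu]
  exact_mod_cast h

theorem B_le_of_encodable_exact_sum {n m L : ℕ}
    (h : EncodableInBits {x : Fin n → ℕ // ∑ j, x j = m} L) :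
    B n (m + n) ≤ L + ⌈Real.logb 2 (((m : ℝ) + n) / n)⌉₊ := by
  rw [encodableInBits_iff, card_exact_sum] at h
  rcases n with _ | k
  · simp [B]
  rw [show k + 1 + m - 1 = m + k by lia, Nat.choose_symm_add] at h
  have hrec : ((m + k : ℕ) + 1 : ℝ) * (m + k).choose k =
      (m + k + 1).choose (k + 1) * (k + 1 : ℕ) := by
    exact_mod_cast Nat.add_one_mul_choose_eq (m + k) k
  refine B_le_add_ceil_logb (by lia) h (le_of_eq ?_)
  rw [← add_assoc, mul_div_assoc', eq_div_iff (by positivity), ← hrec]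
  push_cast
  ring

theorem B_le_of_encodable_multiset {n m L : ℕ}
    (h : EncodableInBits {M : Multiset (Fin m) // M.card = n} L) :
    B n (m + n) ≤ L + ⌈Real.logb 2 ((n : ℝ) + 1)⌉₊ := by
  have hcard : Nat.card {M : Multiset (Fin m) // M.card = n} = (m + n - 1).choose n := by
    change Nat.card (Sym (Fin m) n) = _
    rw [Nat.card_eq_fintype_card, Sym.card_sym_eq_choose, Fintype.card_fin]
  have : Finite {M : Multiset (Fin m) // M.card = n} := inferInstanceAs (Finite (Sym (Fin m) n))
  rw [encodableInBits_iff, hcard] at h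
  rcases m with _ | k
  · refine (B_le_iff (by lia)).2 ?_
    simpa using Nat.one_le_two_pow
  rw [show k + 1 + n - 1 = k + n by lia] at h
  have hrec : ((k + n).choose n : ℝ) * (k + n + 1) = (k + 1 + n).choose n * (k + 1) := by
    have := Nat.choose_mul_succ_eq (k + n) n
    rw [show k + n + 1 - n = k + 1 by lia, show k + n + 1 = k + 1 + n by lia] at this
    rw [show (k : ℝ) + n + 1 = k + 1 + n by ring]
    exact_mod_cast this
  refine B_le_add_ceil_logb (by lia) h
    (le_of_mul_le_mul_right (a := (k + 1 : ℝ)) ?_ (by positivity))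
  rw [← hrec, mul_assoc]
  gcongr
  nlinarith [mul_nonneg n.cast_nonneg k.cast_nonneg (α := ℝ)]

/-! ### Products of binomial coefficients -/

theorem choose_mul_choose_le (a b i j : ℕ) :
    a.choose i * b.choose j ≤ (a + b).choose (i + j) := by
  rw [Nat.add_choose_eq]
  exact Finset.single_le_sum (f := fun ij : ℕ × ℕ => a.choose ij.1 * b.choose ij.2)
    (fun _ _ => Nat.zero_le _) (a := (i, j)) (by simp)

theorem prod_add_choose_le (t : ℕ) (y : ℕ → ℕ) (q : ℕ) :
    ∏ k ∈ Finset.range q, (y k + t).choose t ≤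
      (∑ k ∈ Finset.range q, y k + q * t).choose (q * t) := by
  induction q with
  | zero => simp
  | succ q ih =>
    rw [Finset.prod_range_succ, Finset.sum_range_succ]
    refine (Nat.mul_le_mul_right _ ih).trans ((choose_mul_choose_le _ _ _ _).trans_eq ?_)
    congr 1 <;> ring

theorem add_choose_mono {a b c d : ℕ} (h : a ≤ b) (h' : c ≤ d) :
    (a + c).choose c ≤ (b + d).choose d := by
  calc (a + c).choose c = (a + c).choose a := (Nat.choose_symm_add).symm
    _ ≤ (a + d).choose a := Nat.choose_le_choose _ (by lia)
    _ = (a + d).choose d := Nat.choose_symm_add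
    _ ≤ _ := Nat.choose_le_choose _ (by lia)

theorem add_choose_le_pow (y t : ℕ) : (y + t).choose t ≤ (y + 1) ^ t := by
  induction t with
  | zero => simp
  | succ t ih =>
    have h := Nat.add_one_mul_choose_eq (y + t) t
    rw [pow_succ]
    refine le_of_mul_le_mul_right (a := t + 1) ?_ t.succ_pos
    calc (y + (t + 1)).choose (t + 1) * (t + 1) = (y + t + 1) * (y + t).choose t := h.symm
      _ ≤ ((y + 1) * (t + 1)) * (y + 1) ^ t := Nat.mul_le_mul (by nlinarith) ih
      _ = _ := by ring

theorem two_pow_clog_le {c : ℕ} (hc : 0 < c) : 2 ^ Nat.clog 2 c ≤ 2 * c := by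
  rcases Nat.lt_or_ge 1 c with h | h
  · obtain ⟨k, hk⟩ := Nat.exists_eq_succ_of_ne_zero (Nat.clog_pos one_lt_two h).ne'
    have hpred := Nat.pow_pred_clog_lt_self one_lt_two h
    rw [hk, Nat.pred_succ] at hpred
    rw [hk, pow_succ]
    lia
  · rw [show c = 1 by lia]
    simp

theorem add_one_pow_le (K : ℕ) : (K + 1) ^ K ≤ 4 * K ^ K := by
  rcases Nat.eq_zero_or_pos K with rfl | hK
  · simp
  have h : ((K : ℝ) + 1) ^ K ≤ 4 * K ^ K := by
    have h1 : (1 + 1 / (K : ℝ)) ^ K ≤ 4 := by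
      calc (1 + 1 / (K : ℝ)) ^ K ≤ (Real.exp (1 / K)) ^ K := by
            gcongr
            rw [add_comm]
            exact Real.add_one_le_exp _
        _ = Real.exp 1 := by
            rw [← Real.exp_nat_mul]
            congr 1
            field_simp
        _ ≤ 4 := by linarith [Real.exp_one_lt_d9]
    calc ((K : ℝ) + 1) ^ K = ((1 + 1 / (K : ℝ)) * K) ^ K := by
          congr 1
          field_simp
      _ = (1 + 1 / (K : ℝ)) ^ K * K ^ K := mul_pow _ _ _
      _ ≤ _ := by gcongr
  exact_mod_cast h

theorem add_one_pow_le_two_pow_mul_pow {K : ℕ} (hK : 0 < K) (n : ℕ) :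
    (K + 1) ^ n ≤ 2 ^ (2 * (n / K + 1)) * K ^ n := by
  obtain ⟨d, hd⟩ := Nat.exists_eq_add_of_le (Nat.lt_mul_div_succ n hK).le
  refine le_of_mul_le_mul_right (a := K ^ d) ?_ (by positivity)
  calc (K + 1) ^ n * K ^ d ≤ (K + 1) ^ n * (K + 1) ^ d := by gcongr; lia
    _ = ((K + 1) ^ K) ^ (n / K + 1) := by rw [← pow_add, ← hd, pow_mul]
    _ ≤ (4 * K ^ K) ^ (n / K + 1) := Nat.pow_le_pow_left (add_one_pow_le K) _
    _ = 2 ^ (2 * (n / K + 1)) * K ^ n * K ^ d := by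
      rw [mul_pow, ← pow_mul K, hd, pow_add K, pow_mul 2, mul_assoc]
      norm_num

/-- The `l` low bits of each of `n` values that are sparse in `{0, …, m}` cost almost exactly what
the remaining high parts save. -/
theorem choose_div_two_pow_mul_le {n m l K : ℕ} (hK : 0 < K) (h : l = 0 ∨ n * K ≤ m / 2 ^ l) :
    (m / 2 ^ l + n).choose n * 2 ^ (n * l) ≤ 2 ^ (2 * (n / K + 1)) * (m + n).choose n := by
  rcases h with rfl | h
  · simp only [pow_zero, Nat.div_one, mul_zero, mul_one]
    exact Nat.le_mul_of_pos_left _ (by positivity)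
  set u := m / 2 ^ l
  have hum : u * 2 ^ l ≤ m := Nat.div_mul_le_self _ _
  have hhigh : (u + n).choose n * n.factorial ≤ (u + n) ^ n := by
    rw [mul_comm, ← Nat.ascFactorial_eq_factorial_mul_choose]
    exact Nat.ascFactorial_le_pow_add u n
  have hfull : m ^ n ≤ (m + n).choose n * n.factorial := by
    rw [mul_comm, ← Nat.ascFactorial_eq_factorial_mul_choose]
    exact (Nat.pow_le_pow_left (Nat.le_succ m) n).trans (Nat.pow_succ_le_ascFactorial _ _)
  have hsparse : ((u + n) * K) ^ n ≤ ((K + 1) * u) ^ n := Nat.pow_le_pow_left (by nlinarith) n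
  refine le_of_mul_le_mul_right (a := n.factorial * K ^ n) ?_
    (Nat.mul_pos n.factorial_pos (by positivity))
  calc (u + n).choose n * 2 ^ (n * l) * (n.factorial * K ^ n)
      = ((u + n).choose n * n.factorial) * K ^ n * 2 ^ (n * l) := by ring
    _ ≤ (u + n) ^ n * K ^ n * 2 ^ (n * l) := by gcongr
    _ = ((u + n) * K) ^ n * 2 ^ (n * l) := by rw [mul_pow]
    _ ≤ ((K + 1) * u) ^ n * 2 ^ (n * l) := by gcongr
    _ = (K + 1) ^ n * (u * 2 ^ l) ^ n := by rw [mul_pow, mul_pow, ← pow_mul, mul_comm n l]; ring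
    _ ≤ (2 ^ (2 * (n / K + 1)) * K ^ n) * m ^ n := by
        gcongr
        exact add_one_pow_le_two_pow_mul_pow hK n
    _ ≤ (2 ^ (2 * (n / K + 1)) * K ^ n) * ((m + n).choose n * n.factorial) := by gcongr
    _ = _ := by ring

/-! ### Codes for blocks of increments -/

/-- The number of bits of the code of a block of `t` numbers with sum at most `y`. -/
def codeLength (t y : ℕ) : ℕ := Nat.clog 2 ((y + t).choose t)

theorem codeLength_le_mul {t y a : ℕ} (h : y + 1 ≤ 2 ^ a) : codeLength t y ≤ t * a := by
  refine Nat.clog_le_of_le_pow ((add_choose_le_pow y t).trans ?_)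
  rw [mul_comm, pow_mul]
  exact Nat.pow_le_pow_left h t

theorem two_pow_sum_codeLength_le (t : ℕ) (y : ℕ → ℕ) (q : ℕ) :
    2 ^ (∑ k ∈ Finset.range q, codeLength t (y k)) ≤
      2 ^ q * (∑ k ∈ Finset.range q, y k + q * t).choose (q * t) := by
  refine le_trans ?_ (Nat.mul_le_mul_left _ (prod_add_choose_le t y q))
  rw [← Finset.prod_pow_eq_pow_sum, ← Finset.card_range q, ← Finset.prod_const, Finset.card_range,
    ← Finset.prod_mul_distrib]
  exact Finset.prod_le_prod' fun k _ => two_pow_clog_le (Nat.choose_pos (by lia))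

theorem encodableInBits_codeLength (t y : ℕ) :
    EncodableInBits {x : Fin t → ℕ // ∑ j, x j ≤ y} (codeLength t y) := by
  rw [encodableInBits_iff, card_bounded_sum]
  exact Nat.le_pow_clog one_lt_two _

/-- A fixed optimal code for the blocks of `t` numbers with sum at most `y`. -/
noncomputable def blockCode (t y : ℕ) :
    {x : Fin t → ℕ // ∑ j, x j ≤ y} → BitVec (codeLength t y) :=
  (encodableInBits_codeLength t y).choose

theorem blockCode_injective (t y : ℕ) : Function.Injective (blockCode t y) :=
  (encodableInBits_codeLength t y).choose_spec

instance (t y : ℕ) : Nonempty {x : Fin t → ℕ // ∑ j, x j ≤ y} := ⟨⟨0, by simp⟩⟩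

/-- The sum of the first `j` numbers of the block of `t` numbers with sum at most `y` whose code is
`z`. -/
noncomputable def decodeBlock (t y z j : ℕ) : ℕ :=
  prefixSum (Function.invFun (blockCode t y) (BitVec.ofNat _ z)).1 j

theorem prefixSum_mono {n : ℕ} (x : Fin n → ℕ) : Monotone (prefixSum x) := fun a b h =>
  Finset.sum_le_sum_of_subset fun j hj => by
    simp only [Finset.mem_filter] at hj ⊢
    exact ⟨hj.1, hj.2.trans_le h⟩

theorem prefixSum_le_sum {n : ℕ} (x : Fin n → ℕ) (i : ℕ) : prefixSum x i ≤ ∑ j, x j :=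
  Finset.sum_le_sum_of_subset (Finset.filter_subset _ _)

theorem prefixSum_fin_eq_sum_range {n : ℕ} (x : ℕ → ℕ) {i : ℕ} (h : i ≤ n) :
    prefixSum (fun j : Fin n => x j) i = ∑ j ∈ Finset.range i, x j := by
  rw [prefixSum, Finset.sum_filter, Fin.sum_univ_eq_sum_range (fun j => if j < i then x j else 0) n,
    ← Finset.sum_filter]
  congr 1
  ext j
  simp only [Finset.mem_filter, Finset.mem_range]
  lia

theorem decodeBlock_le (t y z j : ℕ) : decodeBlock t y z j ≤ y :=
  (prefixSum_le_sum _ _).trans (Function.invFun (blockCode t y) (BitVec.ofNat _ z)).2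

theorem sum_range_increments (G : ℕ →o ℕ) (a i : ℕ) :
    ∑ j ∈ Finset.range i, (G (a + j + 1) - G (a + j)) = G (a + i) - G a :=
  Finset.sum_range_tsub (f := fun j => G (a + j)) (G.monotone.comp fun _ _ h => by lia) i

/-- The code of the block of the `t` increments of `G` from `a` on. -/
noncomputable def encodeBlock (t : ℕ) (G : ℕ →o ℕ) (a : ℕ) : ℕ :=
  (blockCode t (G (a + t) - G a) ⟨fun j => G (a + j + 1) - G (a + j), by
    rw [Fin.sum_univ_eq_sum_range fun j => G (a + j + 1) - G (a + j), sum_range_increments]⟩).toNat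

theorem decodeBlock_mod (t y z j : ℕ) :
    decodeBlock t y (z % 2 ^ codeLength t y) j = decodeBlock t y z j := by
  have h : BitVec.ofNat (codeLength t y) (z % 2 ^ codeLength t y) = BitVec.ofNat _ z :=
    BitVec.eq_of_toNat_eq (by simp)
  rw [decodeBlock, h, decodeBlock]

theorem encodeBlock_lt (t : ℕ) (G : ℕ →o ℕ) (a : ℕ) :
    encodeBlock t G a < 2 ^ codeLength t (G (a + t) - G a) :=
  BitVec.isLt _

theorem decodeBlock_encodeBlock {t : ℕ} (G : ℕ →o ℕ) (a : ℕ) {j : ℕ} (hj : j ≤ t) :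
    G a + decodeBlock t (G (a + t) - G a) (encodeBlock t G a) j = G (a + j) := by
  rw [decodeBlock, encodeBlock, BitVec.ofNat_toNat, BitVec.setWidth_eq,
    Function.leftInverse_invFun (blockCode_injective t _),
    prefixSum_fin_eq_sum_range (fun j => G (a + j + 1) - G (a + j)) hj, sum_range_increments,
    Nat.add_sub_cancel' (G.monotone (by lia))]

/-! ### Concatenation of bit fields -/

theorem bitField_zero_of_lt {a f : ℕ} (h : a < 2 ^ f) : bitField a 0 f = a := by
  rw [bitField, pow_zero, Nat.div_one, Nat.mod_eq_of_lt h]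

theorem bitField_bitField (X q : ℕ) {L p f : ℕ} (h : p + f ≤ L) :
    bitField (bitField X q L) p f = bitField X (q + p) f := by
  obtain ⟨d, rfl⟩ := Nat.exists_eq_add_of_le h
  rw [bitField, bitField, bitField, add_assoc, pow_add, Nat.mod_mul_right_div_self,
    Nat.mod_mod_of_dvd _ (pow_dvd_pow 2 (by lia)), Nat.div_div_eq_div_mul, ← pow_add]

/-- The digits of `b` written after the `l` digits of `a`. -/
def joinBits (l a b : ℕ) : ℕ := a + 2 ^ l * b

theorem joinBits_lt {l k a b : ℕ} (ha : a < 2 ^ l) (hb : b < 2 ^ k) :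
    joinBits l a b < 2 ^ (l + k) := by
  rw [joinBits, pow_add]
  nlinarith

theorem bitField_joinBits_left (a b : ℕ) {l p f : ℕ} (h : p + f ≤ l) :
    bitField (joinBits l a b) p f = bitField a p f := by
  have hmod : bitField (joinBits l a b) 0 l = bitField a 0 l := by
    simp [bitField, joinBits]
  have hsub (X : ℕ) := bitField_bitField X 0 h
  simp only [zero_add] at hsub
  rw [← hsub, hmod, hsub]

theorem bitField_joinBits_right {l a : ℕ} (ha : a < 2 ^ l) (b p f : ℕ) :
    bitField (joinBits l a b) (l + p) f = bitField b p f := by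
  rw [bitField, joinBits, pow_add, ← Nat.div_div_eq_div_mul,
    Nat.add_mul_div_left _ _ (by positivity), Nat.div_eq_of_lt ha, zero_add, bitField]

/-- Fields `v 0, v 1, …` of `len 0, len 1, …` bits, stored one after the other. -/
def pack (len v : ℕ → ℕ) : ℕ → ℕ
  | 0 => 0
  | N + 1 => joinBits (∑ k ∈ Finset.range N, len k) (pack len v N) (v N)

section

variable {len v : ℕ → ℕ} {N k : ℕ}

theorem pack_lt (h : ∀ k < N, v k < 2 ^ len k) :
    pack len v N < 2 ^ (∑ k ∈ Finset.range N, len k) := by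
  induction N with
  | zero => simp [pack]
  | succ N ih =>
    rw [pack, Finset.sum_range_succ]
    exact joinBits_lt (ih fun k hk => h k (by lia)) (h N (by lia))

theorem bitField_pack_add {p f : ℕ} (h : ∀ k < N, v k < 2 ^ len k) (hk : k < N)
    (hpf : p + f ≤ len k) :
    bitField (pack len v N) (∑ j ∈ Finset.range k, len j + p) f = bitField (v k) p f := by
  induction N with
  | zero => lia
  | succ N ih =>
    have h' : ∀ k < N, v k < 2 ^ len k := fun k hk => h k (by lia)
    rw [pack]
    rcases Nat.lt_succ_iff_lt_or_eq.1 hk with hkN | rfl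
    · have hsum : ∑ j ∈ Finset.range (k + 1), len j ≤ ∑ j ∈ Finset.range N, len j :=
        Finset.sum_le_sum_of_subset (Finset.range_mono hkN)
      rw [Finset.sum_range_succ] at hsum
      rw [bitField_joinBits_left _ _ (by lia), ih h' hkN]
    · exact bitField_joinBits_right (pack_lt h') ..

theorem bitField_pack (h : ∀ k < N, v k < 2 ^ len k) (hk : k < N) :
    bitField (pack len v N) (∑ j ∈ Finset.range k, len j) (len k) = v k := by
  have := bitField_pack_add (p := 0) h hk (zero_add _).le
  rwa [add_zero, bitField_zero_of_lt (h k hk)] at this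

end

/-- An array of `N` fields of `f` bits. -/
def packArray (f : ℕ) (v : ℕ → ℕ) (N : ℕ) : ℕ := pack (fun _ => f) v N

section

variable {f N : ℕ} {v : ℕ → ℕ}

theorem packArray_lt (h : ∀ k < N, v k < 2 ^ f) : packArray f v N < 2 ^ (N * f) := by
  simpa [packArray] using pack_lt h

theorem bitField_packArray {k : ℕ} (h : ∀ k < N, v k < 2 ^ f) (hk : k < N) :
    bitField (packArray f v N) (k * f) f = v k := by
  simpa [packArray] using bitField_pack h hk

end

/-- `N` records of `d` entries with `f` bits each; `e k q` is the entry `q` of record `k`. -/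
def packRecords (f d : ℕ) (e : ℕ → ℕ → ℕ) (N : ℕ) : ℕ :=
  packArray f (fun k => e (k / d) (k % d)) (N * d)

section

variable {f d N : ℕ} {e : ℕ → ℕ → ℕ}

theorem entry_lt_of_index_lt (he : ∀ k < N, ∀ q < d, e k q < 2 ^ f) :
    ∀ k < N * d, e (k / d) (k % d) < 2 ^ f := fun k hk =>
  he _ (Nat.div_lt_of_lt_mul (by rwa [mul_comm])) _
    (Nat.mod_lt _ (Nat.pos_of_ne_zero fun hd => by simp [hd] at hk))

theorem packRecords_lt (he : ∀ k < N, ∀ q < d, e k q < 2 ^ f) :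
    packRecords f d e N < 2 ^ (N * d * f) :=
  packArray_lt (entry_lt_of_index_lt he)

theorem bitField_packRecords {k q : ℕ} (he : ∀ k < N, ∀ q < d, e k q < 2 ^ f) (hk : k < N)
    (hq : q < d) : bitField (packRecords f d e N) ((k * d + q) * f) f = e k q := by
  rw [packRecords, bitField_packArray (entry_lt_of_index_lt he) (by nlinarith), mul_comm k d,
    Nat.mul_add_div (by lia), Nat.div_eq_of_lt hq, add_zero, Nat.mul_add_mod, Nat.mod_eq_of_lt hq]

end

/-! ### The representation -/

/-- The parameters of a representation of `count` prefix sums, as numbers or as expressions that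
compute them. The `lowWidth` low bits of each value are stored separately. The increments of the
remaining high parts are divided into blocks of `blockSize`, and the blocks into `superCount`
superblocks of `superBlocks` blocks. A superblock is short if its sum is at most `maxSum`; the codes
of its blocks have at most `codeWidth` bits. Numbers that refer to a short superblock have fields of
`localWidth` bits, all others have fields of `globalWidth` bits. -/
structure Params (α : Type) where
  count : α
  lowWidth : α
  blockSize : α
  superBlocks : α
  superCount : α
  maxSum : α
  codeWidth : α
  localWidth : α
  globalWidth : α

namespace Params

section

variable {α : Type} [Add α] [Mul α] [ShiftLeft α] [OfNat α 1] [OfNat α 3] [OfNat α 4]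
  (P : Params α)

/-- The number of increments in a superblock. -/
def superSize : α := P.blockSize * P.superBlocks

/-- The width of the low bits of all values. -/
def lowTotal : α := P.count * P.lowWidth

/-- The width of the directory, which has four entries for each superblock. -/
def directoryWidth : α := P.superCount * 4 * P.globalWidth

/-- The number of pairs of the sum of a block and a string that starts with its code. -/
def tableRows : α := (P.maxSum + 1) <<< P.codeWidth

/-- The width of the table that decodes the blocks. -/
def tableWidth : α := P.tableRows * P.blockSize * P.localWidth

/-- The width of the three numbers stored for each block of a short superblock. -/
def recordsWidth : α := P.superBlocks * 3 * P.localWidth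

/-- The position of entry `q` of superblock `b` in the directory. -/
def directoryPos (b q : α) : α := P.lowTotal + (b * 4 + q) * P.globalWidth

/-- The position of entry `j` of row `k` of the table. -/
def tablePos (k j : α) : α :=
  P.lowTotal + P.directoryWidth + (k * P.blockSize + j) * P.localWidth

/-- The position of the data of the superblocks. -/
def superBase : α := P.lowTotal + P.directoryWidth + P.tableWidth

end

variable (P : Params ℕ) (w : ℕ) (G : ℕ →o ℕ)

/-- The sum of block number `k`. -/
def blockSum (k : ℕ) : ℕ := G (P.blockSize * k + P.blockSize) - G (P.blockSize * k)

/-- Superblock number `b` has a small sum. -/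
def IsShort (b : ℕ) : Prop :=
  G (P.superSize * b + P.superSize) - G (P.superSize * b) ≤ P.maxSum

instance (b : ℕ) : Decidable (P.IsShort G b) := inferInstanceAs (Decidable (_ ≤ _))

/-- The position of the code of block `j` in the data of the short superblock `b`. -/
def codeOffset (b j : ℕ) : ℕ :=
  P.recordsWidth +
    ∑ i ∈ Finset.range j, codeLength P.blockSize (P.blockSum G (P.superBlocks * b + i))

/-- The width of the data of superblock `b`. -/
def superWidth (b : ℕ) : ℕ :=
  if P.IsShort G b then P.codeOffset G b P.superBlocks else P.superSize * P.globalWidth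

/-- The position of the data of superblock `b` among those of all superblocks. -/
def superOffset (b : ℕ) : ℕ := ∑ i ∈ Finset.range b, P.superWidth G i

/-- The numbers stored for block `j` of the short superblock `b`: the sum of the blocks before it in
the superblock, the position of its code, and its sum. -/
def blockEntry (b j : ℕ) : ℕ → ℕ
  | 0 => G (P.blockSize * (P.superBlocks * b + j)) - G (P.superSize * b)
  | 1 => P.codeOffset G b j
  | _ => P.blockSum G (P.superBlocks * b + j)

/-- The data of superblock `b`: if it is short, the numbers and then the codes of its blocks, and
otherwise the answers themselves. -/
noncomputable def superData (b : ℕ) : ℕ :=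
  if P.IsShort G b then
    joinBits P.recordsWidth (packRecords P.localWidth 3 (P.blockEntry G b) P.superBlocks)
      (pack (fun j => codeLength P.blockSize (P.blockSum G (P.superBlocks * b + j)))
        (fun j => encodeBlock P.blockSize G (P.blockSize * (P.superBlocks * b + j))) P.superBlocks)
  else packArray P.globalWidth (fun j => G (P.superSize * b + j + 1)) P.superSize

/-- The directory entries of superblock `b`: the value at its start, whether it is short, and the
position of its data, which need not fit into a word, as a number of words and a number of bits. -/
def superEntry (b : ℕ) : ℕ → ℕ
  | 0 => G (P.superSize * b)
  | 1 => if P.IsShort G b then 1 else 0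
  | 2 => P.superOffset G b / w
  | _ => P.superOffset G b % w

/-- The table entry `j` for the block sum and the string combined in `k`. -/
noncomputable def tableEntry (k j : ℕ) : ℕ :=
  decodeBlock P.blockSize (k / 2 ^ P.codeWidth) (k % 2 ^ P.codeWidth) (j + 1)

/-- The high parts of the values of `H`. -/
def high (H : ℕ →o ℕ) : ℕ →o ℕ :=
  ⟨fun k => H k / 2 ^ P.lowWidth, fun _ _ h => Nat.div_le_div_right (H.monotone h)⟩

/-- The representation of the values `H 1, …, H n`. -/
noncomputable def encode (H : ℕ →o ℕ) : ℕ :=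
  joinBits P.lowTotal (packArray P.lowWidth (fun k => H (k + 1) % 2 ^ P.lowWidth) P.count)
    (joinBits P.directoryWidth
      (packRecords P.globalWidth 4 (P.superEntry w (P.high H)) P.superCount)
      (joinBits P.tableWidth (packRecords P.localWidth P.blockSize P.tableEntry P.tableRows)
        (pack (P.superWidth (P.high H)) (P.superData (P.high H)) P.superCount)))

/-- A bound for the width of the data of a superblock. -/
def superCapacity : ℕ :=
  P.recordsWidth + P.superBlocks * P.codeWidth + P.superSize * P.globalWidth

/-- All fields of the representation are wide enough. -/
structure Valid (P : Params ℕ) : Prop where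
  blockSize_pos : 0 < P.blockSize
  superBlocks_pos : 0 < P.superBlocks
  localWidth_pos : 0 < P.localWidth
  globalWidth_pos : 0 < P.globalWidth
  maxSum_lt : P.maxSum < 2 ^ P.localWidth
  codeLength_le : ∀ y ≤ P.maxSum, codeLength P.blockSize y ≤ P.codeWidth
  records_lt : P.recordsWidth + P.superBlocks * P.codeWidth < 2 ^ P.localWidth
  superCount_mul_lt : P.superCount * P.superCapacity < 2 ^ P.globalWidth

variable {P w G}

theorem tableRows_eq : P.tableRows = (P.maxSum + 1) * 2 ^ P.codeWidth := Nat.shiftLeft_eq ..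

theorem superSize_mul (b : ℕ) : P.superSize * b = P.blockSize * (P.superBlocks * b) :=
  mul_assoc ..

theorem high_sub_le_of_isShort {b k : ℕ} (hb : P.IsShort G b)
    (hk : k ≤ P.superSize * b + P.superSize) : G k - G (P.superSize * b) ≤ P.maxSum :=
  (Nat.sub_le_sub_right (G.monotone hk) _).trans hb

theorem block_end_le {b j : ℕ} (hj : j < P.superBlocks) :
    P.blockSize * (P.superBlocks * b + j) + P.blockSize ≤ P.superSize * b + P.superSize := by
  have := Nat.mul_le_mul_left P.blockSize hj
  rw [superSize_mul, superSize]
  lia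

theorem superStart_le_blockStart (b j : ℕ) :
    P.superSize * b ≤ P.blockSize * (P.superBlocks * b + j) := by
  rw [superSize_mul]
  exact Nat.mul_le_mul_left _ (Nat.le_add_right ..)

theorem blockSum_le {b j : ℕ} (hb : P.IsShort G b) (hj : j < P.superBlocks) :
    P.blockSum G (P.superBlocks * b + j) ≤ P.maxSum :=
  (Nat.sub_le_sub_left (G.monotone (superStart_le_blockStart b j)) _).trans
    (high_sub_le_of_isShort hb (block_end_le hj))

theorem codeOffset_le (hP : P.Valid) {b j : ℕ} (hb : P.IsShort G b) (hj : j ≤ P.superBlocks) :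
    P.codeOffset G b j ≤ P.recordsWidth + P.superBlocks * P.codeWidth := by
  refine Nat.add_le_add_left ?_ _
  calc ∑ i ∈ Finset.range j, codeLength P.blockSize (P.blockSum G (P.superBlocks * b + i))
      ≤ ∑ _i ∈ Finset.range j, P.codeWidth := Finset.sum_le_sum fun i hi =>
        hP.codeLength_le _ (blockSum_le hb ((Finset.mem_range.1 hi).trans_le hj))
    _ = j * P.codeWidth := by simp
    _ ≤ P.superBlocks * P.codeWidth := Nat.mul_le_mul_right _ hj

theorem superWidth_le (hP : P.Valid) (b : ℕ) : P.superWidth G b ≤ P.superCapacity := by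
  rw [superWidth]
  split_ifs with h
  · exact (codeOffset_le hP h le_rfl).trans (Nat.le_add_right ..)
  · exact Nat.le_add_left ..

theorem superOffset_lt (hP : P.Valid) {b : ℕ} (hb : b < P.superCount) :
    P.superOffset G b < 2 ^ P.globalWidth := by
  refine lt_of_le_of_lt ?_ hP.superCount_mul_lt
  calc P.superOffset G b ≤ ∑ _b ∈ Finset.range b, P.superCapacity :=
        Finset.sum_le_sum fun i _ => superWidth_le hP i
    _ = b * P.superCapacity := by simp
    _ ≤ P.superCount * P.superCapacity := Nat.mul_le_mul_right _ hb.le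

theorem blockEntry_lt (hP : P.Valid) {b : ℕ} (hb : P.IsShort G b) :
    ∀ j < P.superBlocks, ∀ q < 3, P.blockEntry G b j q < 2 ^ P.localWidth := by
  intro j hj q _
  match q with
  | 0 =>
    exact (high_sub_le_of_isShort hb ((Nat.le_add_right ..).trans (block_end_le hj))).trans_lt
      hP.maxSum_lt
  | 1 => exact (codeOffset_le hP hb hj.le).trans_lt hP.records_lt
  | _ + 2 => exact (blockSum_le hb hj).trans_lt hP.maxSum_lt

theorem superEntry_lt (hP : P.Valid) (hG : ∀ k, G k < 2 ^ P.globalWidth) :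
    ∀ b < P.superCount, ∀ q < 4, P.superEntry w G b q < 2 ^ P.globalWidth := by
  intro b hb q _
  have hoff := superOffset_lt (G := G) hP hb
  match q with
  | 0 => exact hG _
  | 1 =>
    have := Nat.one_lt_two_pow hP.globalWidth_pos.ne'
    rw [superEntry]
    split_ifs <;> lia
  | 2 => exact (Nat.div_le_self ..).trans_lt hoff
  | _ + 3 => exact (Nat.mod_le ..).trans_lt hoff

theorem tableEntry_lt (hP : P.Valid) :
    ∀ k < P.tableRows, ∀ j < P.blockSize, P.tableEntry k j < 2 ^ P.localWidth := by
  intro k hk j _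
  rw [tableRows_eq, mul_comm] at hk
  have hsum : k / 2 ^ P.codeWidth ≤ P.maxSum := Nat.lt_succ_iff.1 (Nat.div_lt_of_lt_mul hk)
  exact ((decodeBlock_le ..).trans hsum).trans_lt hP.maxSum_lt

theorem superData_lt (hP : P.Valid) (hG : ∀ k, G k < 2 ^ P.globalWidth) (b : ℕ) :
    P.superData G b < 2 ^ P.superWidth G b := by
  rw [superData, superWidth]
  split_ifs with hb
  · exact joinBits_lt (packRecords_lt (blockEntry_lt hP hb)) (pack_lt fun _ _ => encodeBlock_lt ..)
  · exact packArray_lt fun _ _ => hG _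

theorem bitField_superData_blockEntry (hP : P.Valid) {b j q : ℕ} (hb : P.IsShort G b)
    (hj : j < P.superBlocks) (hq : q < 3) :
    bitField (P.superData G b) ((j * 3 + q) * P.localWidth) P.localWidth =
      P.blockEntry G b j q := by
  have hwidth : (j * 3 + q) * P.localWidth + P.localWidth ≤ P.recordsWidth := by
    rw [← Nat.succ_mul]
    exact Nat.mul_le_mul_right _ (by lia)
  rw [superData, if_pos hb, bitField_joinBits_left _ _ hwidth,
    bitField_packRecords (blockEntry_lt hP hb) hj hq]

theorem bitField_superData_code (hP : P.Valid) {b j : ℕ} (hb : P.IsShort G b)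
    (hj : j < P.superBlocks) :
    bitField (P.superData G b) (P.codeOffset G b j)
        (codeLength P.blockSize (P.blockSum G (P.superBlocks * b + j))) =
      encodeBlock P.blockSize G (P.blockSize * (P.superBlocks * b + j)) := by
  rw [superData, if_pos hb, codeOffset,
    bitField_joinBits_right (l := P.recordsWidth) (packRecords_lt (blockEntry_lt hP hb))]
  exact bitField_pack (v := fun j => encodeBlock P.blockSize G _) (fun _ _ => encodeBlock_lt ..) hj

theorem bitField_superData_of_not_isShort (hG : ∀ k, G k < 2 ^ P.globalWidth) {b j : ℕ}
    (hb : ¬P.IsShort G b) (hj : j < P.superSize) :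
    bitField (P.superData G b) (j * P.globalWidth) P.globalWidth = G (P.superSize * b + j + 1) := by
  rw [superData, if_neg hb]
  exact bitField_packArray (v := fun j => G _) (fun _ _ => hG _) hj

section

variable {H : ℕ →o ℕ}

theorem low_lt (P : Params ℕ) (H : ℕ →o ℕ) :
    ∀ k < P.count, H (k + 1) % 2 ^ P.lowWidth < 2 ^ P.lowWidth :=
  fun _ _ => Nat.mod_lt _ (by positivity)

theorem lowArray_lt (P : Params ℕ) (H : ℕ →o ℕ) :
    packArray P.lowWidth (fun k => H (k + 1) % 2 ^ P.lowWidth) P.count < 2 ^ P.lowTotal :=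
  packArray_lt (P.low_lt H)

theorem directory_lt (hP : P.Valid) (hG : ∀ k, G k < 2 ^ P.globalWidth) :
    packRecords P.globalWidth 4 (P.superEntry w G) P.superCount < 2 ^ P.directoryWidth :=
  packRecords_lt (superEntry_lt hP hG)

theorem table_lt (hP : P.Valid) :
    packRecords P.localWidth P.blockSize P.tableEntry P.tableRows < 2 ^ P.tableWidth :=
  packRecords_lt (tableEntry_lt hP)

theorem encode_lt (hP : P.Valid) (hH : ∀ k, P.high H k < 2 ^ P.globalWidth) :
    P.encode w H < 2 ^ (P.superBase + P.superOffset (P.high H) P.superCount) := by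
  rw [superBase, add_assoc, add_assoc]
  exact joinBits_lt (P.lowArray_lt H) (joinBits_lt (directory_lt hP hH)
    (joinBits_lt (table_lt hP) (pack_lt fun b _ => superData_lt hP hH b)))

theorem bitField_encode_low {k : ℕ} (hk : k < P.count) :
    bitField (P.encode w H) (k * P.lowWidth) P.lowWidth = H (k + 1) % 2 ^ P.lowWidth := by
  have hwidth : k * P.lowWidth + P.lowWidth ≤ P.lowTotal := by
    rw [← Nat.succ_mul]
    exact Nat.mul_le_mul_right _ hk
  rw [encode, bitField_joinBits_left _ _ hwidth]
  exact bitField_packArray (P.low_lt H) hk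

theorem bitField_encode_directory (hP : P.Valid) (hH : ∀ k, P.high H k < 2 ^ P.globalWidth)
    {b q : ℕ} (hb : b < P.superCount) (hq : q < 4) :
    bitField (P.encode w H) (P.directoryPos b q) P.globalWidth = P.superEntry w (P.high H) b q := by
  have hwidth : (b * 4 + q) * P.globalWidth + P.globalWidth ≤ P.directoryWidth := by
    rw [← Nat.succ_mul]
    exact Nat.mul_le_mul_right _ (by lia)
  rw [encode, directoryPos, bitField_joinBits_right (P.lowArray_lt H),
    bitField_joinBits_left _ _ hwidth, bitField_packRecords (superEntry_lt hP hH) hb hq]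

theorem bitField_encode_table (hP : P.Valid) (hH : ∀ k, P.high H k < 2 ^ P.globalWidth) {k j : ℕ}
    (hk : k < P.tableRows) (hj : j < P.blockSize) :
    bitField (P.encode w H) (P.tablePos k j) P.localWidth = P.tableEntry k j := by
  have hwidth : (k * P.blockSize + j) * P.localWidth + P.localWidth ≤ P.tableWidth := by
    rw [← Nat.succ_mul]
    exact Nat.mul_le_mul_right _ (by nlinarith)
  rw [encode, tablePos, add_assoc, bitField_joinBits_right (P.lowArray_lt H),
    bitField_joinBits_right (directory_lt hP hH),
    bitField_joinBits_left _ _ hwidth, bitField_packRecords (tableEntry_lt hP) hk hj]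

theorem bitField_encode_superData (hP : P.Valid) (hH : ∀ k, P.high H k < 2 ^ P.globalWidth)
    {b p f : ℕ} (hb : b < P.superCount) (hpf : p + f ≤ P.superWidth (P.high H) b) :
    bitField (P.encode w H) (P.superBase + (P.superOffset (P.high H) b + p)) f =
      bitField (P.superData (P.high H) b) p f := by
  rw [encode, superBase, add_assoc, add_assoc, bitField_joinBits_right (P.lowArray_lt H),
    bitField_joinBits_right (directory_lt hP hH),
    bitField_joinBits_right (table_lt hP)]
  exact bitField_pack_add (fun b _ => superData_lt hP hH b) hb hpf

end

end Params

/-! ### The query -/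

theorem four_mul_le_two_pow {w : ℕ} (hw : 8 ≤ w) : 4 * w ≤ 2 ^ w := by
  induction w, hw using Nat.le_induction with
  | base => norm_num
  | succ k hk ih => rw [pow_succ]; lia

theorem Expr.HasValue.field_zero {σ : State} {r f : Expr} {X R F : ℕ} (hX : σ.Holds X)
    (hr : r.HasValue σ R) (hf : f.HasValue σ F) (hw : 8 ≤ σ.wordSize) (hR : R < 2 ^ σ.wordSize)
    (hv : bitField X R F < 2 ^ σ.wordSize) : (Expr.field 0 r f).HasValue σ (bitField X R F) := by
  have hdiv : R / σ.wordSize ≤ R / 8 := Nat.div_le_div_left hw (by lia)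
  have hlarge := four_mul_le_two_pow hw
  have hzero : (0 : Expr).HasValue σ 0 := const (k := 0) (by positivity)
  have hpos : 0 * σ.wordSize + R = R := by lia
  exact hpos ▸ HasValue.field hX hzero hr hf hR (by lia) (hpos.symm ▸ hv)

theorem Expr.HasValue.byte {σ : State} {k : ℕ} (hk : k < 256) (hw : 8 ≤ σ.wordSize) :
    (Expr.const k).HasValue σ k :=
  const (hk.trans_le (Nat.pow_le_pow_right (n := 2) two_pos hw))

namespace Params

/-- The zero-based index of the queried prefix sum. -/
def index : Expr := .inp 3 - 1

section

variable (E : Params Expr)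

/-- The superblock that contains the queried index. -/
def superIndex : Expr := index / E.superSize

/-- The queried index within its superblock. -/
def inSuper : Expr := index % E.superSize

/-- The block that contains the queried index, within its superblock. -/
def blockIndex : Expr := E.inSuper / E.blockSize

/-- The queried index within its block. -/
def inBlock : Expr := E.inSuper % E.blockSize

/-- Entry `q` of the queried superblock in the directory. -/
def directoryEntry (q : ℕ) : Expr :=
  .field 0 (E.directoryPos E.superIndex (.const q)) E.globalWidth

/-- The field of `f` bits at position `p` of the data of the queried superblock. -/
def superField (p f : Expr) : Expr :=
  .field (E.directoryEntry 2) (E.directoryEntry 3 + E.superBase + p) f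

/-- The high part of the answer in a long superblock. -/
def longAnswer : Expr := E.superField (E.inSuper * E.globalWidth) E.globalWidth

/-- The number `q` stored for the queried block. -/
def queriedEntry (q : ℕ) : Expr :=
  E.superField ((E.blockIndex * 3 + .const q) * E.localWidth) E.localWidth

/-- The row of the table for the queried block. Its code is followed by arbitrary bits. -/
def tableRow : Expr :=
  E.queriedEntry 2 <<< E.codeWidth + E.superField (E.queriedEntry 1) E.codeWidth

/-- The sum of the increments in the block up to the queried one. -/
def inBlockSum : Expr := .field 0 (E.tablePos E.tableRow E.inBlock) E.localWidth

/-- The high part of the answer in a short superblock. -/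
def shortAnswer : Expr := E.directoryEntry 0 + E.queriedEntry 0 + E.inBlockSum

/-- The high part of the answer. -/
def highAnswer : Expr := .select (E.directoryEntry 1) E.shortAnswer E.longAnswer

/-- The low bits of the answer. -/
def lowAnswer : Expr := .field 0 (index * E.lowWidth) E.lowWidth

/-- The queried prefix sum. -/
def answer : Expr := E.highAnswer <<< E.lowWidth + E.lowAnswer

end

/-- In the state `σ` the expressions `E` have the values `P`. -/
structure HasValues (σ : State) (E : Params Expr) (P : Params ℕ) : Prop where
  count : E.count.HasValue σ P.count
  lowWidth : E.lowWidth.HasValue σ P.lowWidth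
  blockSize : E.blockSize.HasValue σ P.blockSize
  superBlocks : E.superBlocks.HasValue σ P.superBlocks
  superCount : E.superCount.HasValue σ P.superCount
  maxSum : E.maxSum.HasValue σ P.maxSum
  codeWidth : E.codeWidth.HasValue σ P.codeWidth
  localWidth : E.localWidth.HasValue σ P.localWidth
  globalWidth : E.globalWidth.HasValue σ P.globalWidth

/-- The representation of `H` can be built with words of `w` bits: its fields are wide enough, and
all positions can be computed without overflow. -/
structure Fits (P : Params ℕ) (w : ℕ) (H : ℕ →o ℕ) : Prop where
  valid : P.Valid
  high_lt : ∀ k, P.high H k < 2 ^ P.globalWidth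
  value_lt : ∀ k, H k < 2 ^ w
  eight_le : 8 ≤ w
  count_lt : P.count < 2 ^ w
  lowTotal_lt : 2 * P.lowTotal < 2 ^ w
  overhead_le : 4 * (P.directoryWidth + P.tableWidth + P.superCapacity) ≤ 2 ^ w
  superOffset_le : P.superOffset (P.high H) P.superCount ≤ 2 ^ (w + 1)

/-- In the state `σ` the value with index `i` is queried in the representation of `H`. -/
structure Queries (σ : State) (E : Params Expr) (P : Params ℕ) (H : ℕ →o ℕ) (i : ℕ) : Prop
    extends P.Fits σ.wordSize H where
  values : HasValues σ E P
  holds : σ.Holds (P.encode σ.wordSize H)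
  input_three : σ.input 3 = i + 1
  index_lt : i < P.count
  superIndex_lt : i / P.superSize < P.superCount

section

variable {P : Params ℕ}

theorem superSize_pos (hP : P.Valid) : 0 < P.superSize :=
  Nat.mul_pos hP.blockSize_pos hP.superBlocks_pos

theorem superSize_mul_globalWidth_le (P : Params ℕ) :
    P.superSize * P.globalWidth ≤ P.superCapacity :=
  Nat.le_add_left ..

theorem superSize_le (hP : P.Valid) : P.superSize ≤ P.superCapacity :=
  (Nat.le_mul_of_pos_right _ hP.globalWidth_pos).trans P.superSize_mul_globalWidth_le

theorem recordsWidth_le (P : Params ℕ) : P.recordsWidth ≤ P.superCapacity := by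
  rw [superCapacity]
  lia

theorem tableRows_mul_blockSize_le (hP : P.Valid) : P.tableRows * P.blockSize ≤ P.tableWidth :=
  Nat.le_mul_of_pos_right _ hP.localWidth_pos

theorem tableRows_le (hP : P.Valid) : P.tableRows ≤ P.tableWidth :=
  (Nat.le_mul_of_pos_right _ hP.blockSize_pos).trans (tableRows_mul_blockSize_le hP)

theorem inSuper_lt (hP : P.Valid) (i : ℕ) : i % P.superSize < P.superSize :=
  Nat.mod_lt _ (superSize_pos hP)

theorem blockIndex_lt (hP : P.Valid) (i : ℕ) :
    i % P.superSize / P.blockSize < P.superBlocks :=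
  Nat.div_lt_of_lt_mul (inSuper_lt hP i)

theorem inBlock_lt (hP : P.Valid) (i : ℕ) : i % P.superSize % P.blockSize < P.blockSize :=
  Nat.mod_lt _ hP.blockSize_pos

theorem blockStart_add_inBlock (P : Params ℕ) (i : ℕ) :
    P.blockSize * (P.superBlocks * (i / P.superSize) + i % P.superSize / P.blockSize) +
      i % P.superSize % P.blockSize = i := by
  rw [mul_add, add_assoc, Nat.div_add_mod, ← superSize_mul, Nat.div_add_mod]

theorem codeOffset_add_codeLength_le {G : ℕ →o ℕ} {b j : ℕ} (hb : P.IsShort G b)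
    (hj : j < P.superBlocks) :
    P.codeOffset G b j + codeLength P.blockSize (P.blockSum G (P.superBlocks * b + j)) ≤
      P.superWidth G b := by
  rw [superWidth, if_pos hb, codeOffset, codeOffset, add_assoc,
    ← Finset.sum_range_succ fun j =>
      codeLength P.blockSize (P.blockSum G (P.superBlocks * b + j))]
  exact Nat.add_le_add_left (Finset.sum_le_sum_of_subset (Finset.range_mono hj)) _

/-- The bits that follow the code of a block in the string do not influence its decoding. -/
theorem tableEntry_eq {G : ℕ →o ℕ} {a j z : ℕ} (hj : j < P.blockSize) (hz : z < 2 ^ P.codeWidth)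
    (hcode : z % 2 ^ codeLength P.blockSize (G (a + P.blockSize) - G a) =
      encodeBlock P.blockSize G a) :
    G a + P.tableEntry ((G (a + P.blockSize) - G a) * 2 ^ P.codeWidth + z) j = G (a + j + 1) := by
  rw [tableEntry, mul_comm _ (2 ^ P.codeWidth), Nat.mul_add_div (by positivity),
    Nat.div_eq_of_lt hz, add_zero, Nat.mul_add_mod, Nat.mod_eq_of_lt hz, ← decodeBlock_mod, hcode,
    decodeBlock_encodeBlock G a hj, add_assoc]

theorem superOffset_le_total (G : ℕ →o ℕ) {b : ℕ} (hb : b ≤ P.superCount) :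
    P.superOffset G b ≤ P.superOffset G P.superCount :=
  Finset.sum_le_sum_of_subset (Finset.range_mono hb)

end

namespace Queries

variable {σ : State} {E : Params Expr} {P : Params ℕ} {H : ℕ →o ℕ} {i : ℕ}

theorem const_hasValue (h : Queries σ E P H i) {k : ℕ} (hk : k < 256) :
    (Expr.const k).HasValue σ k :=
  .byte hk h.eight_le

theorem index_hasValue (h : Queries σ E P H i) : index.HasValue σ i :=
  Expr.HasValue.sub (show (Expr.inp 3).HasValue σ (i + 1) from h.input_three)
    (h.const_hasValue (k := 1) (by lia)) (by lia) (Nat.lt_of_le_of_lt h.index_lt h.count_lt)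

theorem superSize_hasValue (h : Queries σ E P H i) : E.superSize.HasValue σ P.superSize :=
  h.values.blockSize.mul h.values.superBlocks
    ((superSize_le h.valid).trans_lt (by have := h.overhead_le; have := h.count_lt; lia))

theorem superIndex_hasValue (h : Queries σ E P H i) :
    E.superIndex.HasValue σ (i / P.superSize) :=
  h.index_hasValue.div h.superSize_hasValue

theorem inSuper_hasValue (h : Queries σ E P H i) : E.inSuper.HasValue σ (i % P.superSize) :=
  h.index_hasValue.mod h.superSize_hasValue (h.index_lt.trans h.count_lt)

theorem blockIndex_hasValue (h : Queries σ E P H i) :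
    E.blockIndex.HasValue σ (i % P.superSize / P.blockSize) :=
  h.inSuper_hasValue.div h.values.blockSize

theorem inBlock_hasValue (h : Queries σ E P H i) :
    E.inBlock.HasValue σ (i % P.superSize % P.blockSize) :=
  h.inSuper_hasValue.mod h.values.blockSize
    ((Nat.mod_le ..).trans_lt (h.index_lt.trans h.count_lt))

theorem lowTotal_hasValue (h : Queries σ E P H i) : E.lowTotal.HasValue σ P.lowTotal :=
  h.values.count.mul h.values.lowWidth (by have := h.lowTotal_lt; rw [lowTotal] at this; lia)

theorem directoryWidth_hasValue (h : Queries σ E P H i) :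
    E.directoryWidth.HasValue σ P.directoryWidth := by
  have hD : P.directoryWidth < 2 ^ σ.wordSize := by
    have := h.overhead_le
    have := h.count_lt
    lia
  exact (h.values.superCount.mul (h.const_hasValue (k := 4) (by lia))
    ((Nat.le_mul_of_pos_right _ h.valid.globalWidth_pos).trans_lt hD)).mul h.values.globalWidth hD

theorem tableWidth_hasValue (h : Queries σ E P H i) :
    E.tableWidth.HasValue σ P.tableWidth := by
  have hT : P.tableWidth < 2 ^ σ.wordSize := by
    have := h.overhead_le
    have := h.count_lt
    lia
  have hrows := (tableRows_le h.valid).trans_lt hT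
  have hmaxSum : P.maxSum + 1 ≤ P.tableRows := by
    rw [tableRows_eq]
    exact Nat.le_mul_of_pos_right _ (by positivity)
  have hvalue : E.tableRows.HasValue σ P.tableRows := by
    rw [tableRows_eq] at hmaxSum hrows ⊢
    exact (h.values.maxSum.add (h.const_hasValue (k := 1) (by lia)) (by lia)).shiftLeft
      h.values.codeWidth hrows
  exact (hvalue.mul h.values.blockSize
    ((tableRows_mul_blockSize_le h.valid).trans_lt hT)).mul h.values.localWidth hT

theorem superBase_hasValue (h : Queries σ E P H i) :
    E.superBase.HasValue σ P.superBase := by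
  have := h.lowTotal_lt
  have := h.overhead_le
  exact (h.lowTotal_hasValue.add h.directoryWidth_hasValue (by lia)).add h.tableWidth_hasValue
    (by lia)

theorem directoryEntry_hasValue (h : Queries σ E P H i) {q : ℕ} (hq : q < 4)
    (hv : P.superEntry σ.wordSize (P.high H) (i / P.superSize) q < 2 ^ σ.wordSize) :
    (E.directoryEntry q).HasValue σ
      (P.superEntry σ.wordSize (P.high H) (i / P.superSize) q) := by
  set b := i / P.superSize with hb
  have hbr : b < P.superCount := h.superIndex_lt
  have hpos : (b * 4 + q) * P.globalWidth ≤ P.directoryWidth :=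
    Nat.mul_le_mul_right _ (by lia)
  have hidx : b * 4 + q ≤ (b * 4 + q) * P.globalWidth :=
    Nat.le_mul_of_pos_right _ h.valid.globalWidth_pos
  have := h.lowTotal_lt
  have := h.overhead_le
  have hp : (E.directoryPos E.superIndex (.const q)).HasValue σ (P.directoryPos b q) :=
    h.lowTotal_hasValue.add (((h.superIndex_hasValue.mul (h.const_hasValue (k := 4) (by lia))
      (by lia)).add (h.const_hasValue (by lia)) (by lia)).mul h.values.globalWidth (by lia))
      (by lia)
  have hread := bitField_encode_directory (w := σ.wordSize) h.valid h.high_lt hbr hq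
  rw [← hread] at hv ⊢
  exact .field_zero h.holds hp h.values.globalWidth h.eight_le (by rw [directoryPos]; lia) hv

theorem superField_hasValue (h : Queries σ E P H i) {p f : Expr} {R F v : ℕ}
    (hp : p.HasValue σ R) (hf : f.HasValue σ F) (hR : R ≤ P.superCapacity)
    (hread : bitField (P.encode σ.wordSize H)
      (P.superBase + (P.superOffset (P.high H) (i / P.superSize) + R)) F = v)
    (hv : v < 2 ^ σ.wordSize) : (E.superField p f).HasValue σ v := by
  obtain ⟨O, hO⟩ : ∃ O, P.superOffset (P.high H) (i / P.superSize) = O := ⟨_, rfl⟩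
  have hOtotal : O ≤ 2 ^ (σ.wordSize + 1) :=
    hO ▸ (superOffset_le_total _ h.superIndex_lt.le).trans h.superOffset_le
  rw [hO] at hread
  rw [pow_succ] at hOtotal
  have hbase : P.superBase = P.lowTotal + P.directoryWidth + P.tableWidth := rfl
  have h8 := h.eight_le
  have hlarge := four_mul_le_two_pow h8
  have hmod : O % σ.wordSize < σ.wordSize := Nat.mod_lt _ (by lia)
  have hdiv (k : ℕ) : k / σ.wordSize ≤ k / 8 := Nat.div_le_div_left h8 (by lia)
  have hOdiv := hdiv O
  have hpdiv := hdiv (O % σ.wordSize + P.superBase + R)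
  have := h.lowTotal_lt
  have := h.overhead_le
  have hstart : (E.directoryEntry 2).HasValue σ (O / σ.wordSize) :=
    hO ▸ h.directoryEntry_hasValue (q := 2) (by lia)
      (show P.superOffset _ _ / _ < _ by rw [hO]; lia)
  have hbits : (E.directoryEntry 3).HasValue σ (O % σ.wordSize) :=
    hO ▸ h.directoryEntry_hasValue (q := 3) (by lia)
      (show P.superOffset _ _ % _ < _ by rw [hO]; lia)
  have hsplit : O / σ.wordSize * σ.wordSize + (O % σ.wordSize + P.superBase + R) =
      P.superBase + (O + R) := by
    have := Nat.div_add_mod' O σ.wordSize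
    lia
  rw [← hread, ← hsplit] at hv ⊢
  exact .field h.holds hstart ((hbits.add h.superBase_hasValue (by lia)).add hp (by lia)) hf
    (by lia) (by omega) hv

theorem high_lt_two_pow (h : Queries σ E P H i) (k : ℕ) : P.high H k < 2 ^ σ.wordSize :=
  (Nat.div_le_self ..).trans_lt (h.value_lt k)

theorem longAnswer_hasValue (h : Queries σ E P H i)
    (hb : ¬P.IsShort (P.high H) (i / P.superSize)) :
    E.longAnswer.HasValue σ (P.high H (i + 1)) := by
  have hk := inSuper_lt h.valid i
  have hcap := P.superSize_mul_globalWidth_le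
  have hpos : (i % P.superSize) * P.globalWidth + P.globalWidth ≤
      P.superSize * P.globalWidth := by
    rw [← Nat.succ_mul]
    exact Nat.mul_le_mul_right _ hk
  have hread := bitField_encode_superData (w := σ.wordSize) h.valid h.high_lt h.superIndex_lt
    (hpos.trans_eq (if_neg hb).symm)
  rw [bitField_superData_of_not_isShort h.high_lt hb hk, Nat.div_add_mod] at hread
  have := h.overhead_le
  have := h.count_lt
  exact h.superField_hasValue (h.inSuper_hasValue.mul h.values.globalWidth (by lia))
    h.values.globalWidth (by lia) hread (h.high_lt_two_pow _)

theorem blockEntry_lt_two_pow (h : Queries σ E P H i)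
    (hb : P.IsShort (P.high H) (i / P.superSize)) (q : ℕ) :
    P.blockEntry (P.high H) (i / P.superSize) (i % P.superSize / P.blockSize) q <
      2 ^ σ.wordSize := by
  have := h.overhead_le
  have := h.count_lt
  match q with
  | 0 => exact (Nat.sub_le ..).trans_lt (h.high_lt_two_pow _)
  | 1 =>
    have := codeOffset_le h.valid hb (blockIndex_lt h.valid i).le
    rw [blockEntry]
    rw [superCapacity] at *
    lia
  | _ + 2 => exact (Nat.sub_le ..).trans_lt (h.high_lt_two_pow _)

theorem queriedEntry_hasValue (h : Queries σ E P H i)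
    (hb : P.IsShort (P.high H) (i / P.superSize)) {q : ℕ} (hq : q < 3) :
    (E.queriedEntry q).HasValue σ
      (P.blockEntry (P.high H) (i / P.superSize) (i % P.superSize / P.blockSize) q) := by
  set j := i % P.superSize / P.blockSize
  have hjs : j < P.superBlocks := blockIndex_lt h.valid i
  have hpos : (j * 3 + q) * P.localWidth + P.localWidth ≤ P.recordsWidth := by
    rw [← Nat.succ_mul]
    exact Nat.mul_le_mul_right _ (by lia)
  have hidx : j * 3 + q ≤ (j * 3 + q) * P.localWidth :=
    Nat.le_mul_of_pos_right _ h.valid.localWidth_pos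
  have hrecords : P.recordsWidth ≤ P.superWidth (P.high H) (i / P.superSize) :=
    (Nat.le_add_right ..).trans_eq (if_pos hb).symm
  have hread := bitField_encode_superData (w := σ.wordSize) h.valid h.high_lt h.superIndex_lt
    (hpos.trans hrecords)
  rw [bitField_superData_blockEntry h.valid hb hjs hq] at hread
  have := P.recordsWidth_le
  have := h.overhead_le
  have := h.count_lt
  exact h.superField_hasValue (((h.blockIndex_hasValue.mul (h.const_hasValue (k := 3) (by lia))
    (by lia)).add (h.const_hasValue (by lia)) (by lia)).mul h.values.localWidth (by lia))
    h.values.localWidth (by lia) hread (h.blockEntry_lt_two_pow hb q)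

/-- The window of `codeWidth` bits at the code of a block may extend beyond the code, and even
beyond the data of the superblock. -/
theorem exists_tableRow_hasValue (h : Queries σ E P H i)
    (hb : P.IsShort (P.high H) (i / P.superSize)) {k : ℕ}
    (hk : k = P.superBlocks * (i / P.superSize) + i % P.superSize / P.blockSize) :
    ∃ z < 2 ^ P.codeWidth,
      z % 2 ^ codeLength P.blockSize (P.blockSum (P.high H) k) =
        encodeBlock P.blockSize (P.high H) (P.blockSize * k) ∧
      P.blockSum (P.high H) k * 2 ^ P.codeWidth + z < P.tableRows ∧
      E.tableRow.HasValue σ (P.blockSum (P.high H) k * 2 ^ P.codeWidth + z) := by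
  subst hk
  set b := i / P.superSize
  set j := i % P.superSize / P.blockSize
  have hjs : j < P.superBlocks := blockIndex_lt h.valid i
  set pos := P.codeOffset (P.high H) b j
  have hsum : P.blockSum (P.high H) (P.superBlocks * b + j) ≤ P.maxSum := blockSum_le hb hjs
  set y := P.blockSum (P.high H) (P.superBlocks * b + j)
  set z := bitField (P.encode σ.wordSize H)
    (P.superBase + (P.superOffset (P.high H) b + pos)) P.codeWidth with hz
  have hzlt : z < 2 ^ P.codeWidth := bitField_lt ..
  have hcode : z % 2 ^ codeLength P.blockSize y =
      encodeBlock P.blockSize (P.high H) (P.blockSize * (P.superBlocks * b + j)) := by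
    rw [hz, bitField_mod_two_pow ((bitField_lt ..).trans_le
      (Nat.pow_le_pow_right two_pos (h.valid.codeLength_le y hsum))),
      bitField_encode_superData h.valid h.high_lt h.superIndex_lt
        (codeOffset_add_codeLength_le hb hjs), bitField_superData_code h.valid hb hjs]
  have hrow : y * 2 ^ P.codeWidth + z < P.tableRows := by
    rw [tableRows_eq]
    nlinarith [Nat.mul_le_mul_right (2 ^ P.codeWidth) hsum]
  have hrows := tableRows_le h.valid
  have hpos := codeOffset_le h.valid hb hjs.le
  have := h.overhead_le
  have hwindow := h.superField_hasValue (h.queriedEntry_hasValue hb (q := 1) (by lia))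
    h.values.codeWidth (hpos.trans (Nat.le_add_right ..)) hz.symm (by lia)
  exact ⟨z, hzlt, hcode, hrow, ((h.queriedEntry_hasValue hb (q := 2) (by lia)).shiftLeft
    h.values.codeWidth (show y * _ < _ by lia)).add hwindow (show y * _ + _ < _ by lia)⟩

theorem inBlockSum_hasValue (h : Queries σ E P H i) {k : ℕ} (hk : k < P.tableRows)
    (hrow : E.tableRow.HasValue σ k) :
    E.inBlockSum.HasValue σ (P.tableEntry k (i % P.superSize % P.blockSize)) := by
  set e := i % P.superSize % P.blockSize
  have het : e < P.blockSize := inBlock_lt h.valid i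
  have hindex : k * P.blockSize + e < P.tableRows * P.blockSize := by nlinarith
  have hpos : (k * P.blockSize + e) * P.localWidth ≤ P.tableWidth :=
    Nat.mul_le_mul_right _ hindex.le
  have hrows := tableRows_mul_blockSize_le h.valid
  have hread := bitField_encode_table (w := σ.wordSize) h.valid h.high_lt hk het
  have := h.lowTotal_lt
  have := h.overhead_le
  have hp : (E.tablePos E.tableRow E.inBlock).HasValue σ (P.tablePos k e) :=
    (h.lowTotal_hasValue.add h.directoryWidth_hasValue (by lia)).add
      (((hrow.mul h.values.blockSize (by lia)).add h.inBlock_hasValue (by lia)).mul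
        h.values.localWidth (by lia)) (by lia)
  have hentry : P.tableEntry k e < 2 ^ σ.wordSize := by
    have hle : P.tableEntry k e ≤ k / 2 ^ P.codeWidth := decodeBlock_le ..
    have := Nat.div_le_self k (2 ^ P.codeWidth)
    have := tableRows_le h.valid
    lia
  rw [← hread] at hentry ⊢
  exact .field_zero h.holds hp h.values.localWidth h.eight_le (by rw [tablePos]; lia) hentry

theorem shortAnswer_hasValue (h : Queries σ E P H i)
    (hb : P.IsShort (P.high H) (i / P.superSize)) :
    E.shortAnswer.HasValue σ (P.high H (i + 1)) := by
  set a := P.superBlocks * (i / P.superSize) + i % P.superSize / P.blockSize with ha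
  obtain ⟨z, hz, hcode, hrow, hvalue⟩ := h.exists_tableRow_hasValue hb ha
  have hsum := h.inBlockSum_hasValue hrow hvalue
  have hresult := tableEntry_eq (inBlock_lt h.valid i) hz hcode
  rw [P.blockStart_add_inBlock i] at hresult
  have hstart := h.directoryEntry_hasValue (q := 0) (by lia) (h.high_lt_two_pow _)
  have hbefore := h.queriedEntry_hasValue hb (q := 0) (by lia)
  have hblock : P.high H (P.superSize * (i / P.superSize)) +
      (P.high H (P.blockSize * a) - P.high H (P.superSize * (i / P.superSize))) =
        P.high H (P.blockSize * a) :=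
    Nat.add_sub_cancel' ((P.high H).monotone (superStart_le_blockStart ..))
  have hstartBlock : (E.directoryEntry 0 + E.queriedEntry 0).HasValue σ
      (P.high H (P.blockSize * a)) := by
    rw [← hblock]
    exact hstart.add hbefore (hblock.trans_lt (h.high_lt_two_pow _))
  exact hresult ▸ hstartBlock.add hsum (hresult ▸ h.high_lt_two_pow _)

theorem highAnswer_hasValue (h : Queries σ E P H i) :
    E.highAnswer.HasValue σ (P.high H (i + 1)) := by
  have h8 := h.eight_le
  have hflag : P.superEntry σ.wordSize (P.high H) (i / P.superSize) 1 =
      if P.IsShort (P.high H) (i / P.superSize) then 1 else 0 := rfl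
  have hentry := h.directoryEntry_hasValue (q := 1) (by lia)
  by_cases hb : P.IsShort (P.high H) (i / P.superSize)
  · rw [hflag, if_pos hb] at hentry
    exact (hentry (Nat.one_lt_two_pow (by lia))).select_one (h.shortAnswer_hasValue hb) (by lia)
      (h.high_lt_two_pow _)
  · rw [hflag, if_neg hb] at hentry
    exact (hentry (by positivity)).select_zero (h.longAnswer_hasValue hb) (by lia)
      (h.high_lt_two_pow _)

theorem answer_hasValue (h : Queries σ E P H i) : E.answer.HasValue σ (H (i + 1)) := by
  have hpos : i * P.lowWidth ≤ P.lowTotal := Nat.mul_le_mul_right _ h.index_lt.le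
  have := h.lowTotal_lt
  have hread := bitField_encode_low (w := σ.wordSize) (H := H) h.index_lt
  have hlow : E.lowAnswer.HasValue σ (H (i + 1) % 2 ^ P.lowWidth) := by
    rw [← hread]
    refine .field_zero h.holds (h.index_hasValue.mul h.values.lowWidth (by lia))
      h.values.lowWidth h.eight_le (by lia) ?_
    rw [hread]
    exact (Nat.mod_le ..).trans_lt (h.value_lt _)
  have hsplit : P.high H (i + 1) * 2 ^ P.lowWidth + H (i + 1) % 2 ^ P.lowWidth = H (i + 1) :=
    Nat.div_add_mod' ..
  have hH := h.value_lt (i + 1)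
  rw [← hsplit] at hH ⊢
  exact (h.highAnswer_hasValue.shiftLeft h.values.lowWidth (by lia)).add hlow hH

end Queries

end Params

/-! ### Space -/

theorem sum_range_sum_range (f : ℕ → ℕ) (s r : ℕ) :
    ∑ b ∈ Finset.range r, ∑ j ∈ Finset.range s, f (s * b + j) =
      ∑ k ∈ Finset.range (s * r), f k := by
  induction r with
  | zero => simp
  | succ r ih => rw [Finset.sum_range_succ, ih, Nat.mul_succ, Finset.sum_range_add]

theorem sum_sub_le_of_monotone {G : ℕ → ℕ} (hG : Monotone G) {u : ℕ} (hu : ∀ k, G k ≤ u)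
    (t q : ℕ) : ∑ k ∈ Finset.range q, (G (t * k + t) - G (t * k)) ≤ u := by
  have h : Monotone fun k => G (t * k) := fun a b hab => hG (Nat.mul_le_mul_left _ hab)
  exact (Finset.sum_range_tsub h q).trans_le ((Nat.sub_le ..).trans (hu _))

namespace Params

variable {P : Params ℕ} {G : ℕ →o ℕ} {n u : ℕ}

/-- The width of the code of block `k` if the block is part of a short superblock. -/
def shortCodeLength (P : Params ℕ) (G : ℕ →o ℕ) (k : ℕ) : ℕ :=
  if P.IsShort G (k / P.superBlocks) then codeLength P.blockSize (P.blockSum G k) else 0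

theorem shortCodeLength_le_codeLength (P : Params ℕ) (G : ℕ →o ℕ) (k : ℕ) :
    P.shortCodeLength G k ≤ codeLength P.blockSize (P.blockSum G k) := by
  rw [shortCodeLength]
  split_ifs <;> lia

theorem shortCodeLength_le (hP : P.Valid) (G : ℕ →o ℕ) (k : ℕ) :
    P.shortCodeLength G k ≤ P.codeWidth := by
  rw [shortCodeLength]
  split_ifs with h
  · have hk := blockSum_le h (Nat.mod_lt k hP.superBlocks_pos)
    rw [Nat.div_add_mod] at hk
    exact hP.codeLength_le _ hk
  · exact Nat.zero_le _

theorem shortCodeLength_eq_zero (hP : P.Valid) (hn : ∀ k ≥ n, G k = G n) {k : ℕ}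
    (hk : n / P.blockSize < k) : P.shortCodeLength G k = 0 := by
  have hstart : n ≤ P.blockSize * k :=
    (Nat.lt_mul_div_succ n hP.blockSize_pos).le.trans (Nat.mul_le_mul_left _ hk)
  have hsum : P.blockSum G k = 0 := by
    rw [blockSum, hn _ hstart, hn _ (hstart.trans (Nat.le_add_right ..)), Nat.sub_self]
  simp [shortCodeLength, hsum, codeLength]

/-- Only the last of the blocks in use may be incomplete. -/
theorem sum_shortCodeLength_le (hP : P.Valid) (hn : ∀ k ≥ n, G k = G n) (q : ℕ) :
    ∑ k ∈ Finset.range q, P.shortCodeLength G k ≤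
      ∑ k ∈ Finset.range (n / P.blockSize), codeLength P.blockSize (P.blockSum G k) +
        P.codeWidth :=
  calc ∑ k ∈ Finset.range q, P.shortCodeLength G k
      ≤ ∑ k ∈ Finset.range (n / P.blockSize + 1), P.shortCodeLength G k := by
        refine Finset.sum_le_sum_of_ne_zero fun k _ hk => ?_
        by_contra hkn
        rw [Finset.mem_range, not_lt] at hkn
        exact hk (shortCodeLength_eq_zero hP hn hkn)
    _ ≤ _ := by
        rw [Finset.sum_range_succ]
        exact Nat.add_le_add
          (Finset.sum_le_sum fun k _ => P.shortCodeLength_le_codeLength G k)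
          (shortCodeLength_le hP G _)

theorem card_long_le (hu : ∀ k, G k ≤ u) (hmax : 0 < P.maxSum) (r : ℕ) :
    (Finset.range r |>.filter fun b => ¬P.IsShort G b).card ≤ u / P.maxSum := by
  rw [Nat.le_div_iff_mul_le hmax]
  calc _ ≤ ∑ b ∈ Finset.range r with ¬P.IsShort G b,
        (G (P.superSize * b + P.superSize) - G (P.superSize * b)) :=
        Finset.card_nsmul_le_sum _ _ _ fun b hb => (not_le.1 (Finset.mem_filter.1 hb).2).le
    _ ≤ ∑ b ∈ Finset.range r, (G (P.superSize * b + P.superSize) - G (P.superSize * b)) :=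
        Finset.sum_le_sum_of_subset (Finset.filter_subset ..)
    _ ≤ u := sum_sub_le_of_monotone G.monotone hu ..

theorem superWidth_le_shortCodeLength (hP : P.Valid) (G : ℕ →o ℕ) (b : ℕ) :
    P.superWidth G b ≤ P.recordsWidth +
      ∑ j ∈ Finset.range P.superBlocks, P.shortCodeLength G (P.superBlocks * b + j) +
      if P.IsShort G b then 0 else P.superSize * P.globalWidth := by
  rw [superWidth]
  split_ifs with hb
  · rw [codeOffset, add_zero]
    refine Nat.add_le_add_left (Finset.sum_le_sum fun j hj => ?_) _
    rw [shortCodeLength, Nat.mul_add_div hP.superBlocks_pos,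
      Nat.div_eq_of_lt (Finset.mem_range.1 hj), add_zero, if_pos hb]
  · exact Nat.le_add_left ..

theorem superOffset_le (hP : P.Valid) (hn : ∀ k ≥ n, G k = G n) (hu : ∀ k, G k ≤ u)
    (hmax : 0 < P.maxSum) (r : ℕ) :
    P.superOffset G r ≤ r * P.recordsWidth +
      (∑ k ∈ Finset.range (n / P.blockSize), codeLength P.blockSize (P.blockSum G k) +
        P.codeWidth) + u / P.maxSum * (P.superSize * P.globalWidth) :=
  calc P.superOffset G r
      ≤ r * P.recordsWidth + ∑ k ∈ Finset.range (P.superBlocks * r), P.shortCodeLength G k +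
        (Finset.range r |>.filter fun b => ¬P.IsShort G b).card *
          (P.superSize * P.globalWidth) := by
        refine (Finset.sum_le_sum fun b _ => superWidth_le_shortCodeLength hP G b).trans_eq ?_
        rw [Finset.sum_add_distrib, Finset.sum_add_distrib, Finset.sum_const, Finset.card_range,
          smul_eq_mul, sum_range_sum_range, Finset.sum_ite, Finset.sum_const_zero, zero_add,
          Finset.sum_const, smul_eq_mul]
    _ ≤ _ := Nat.add_le_add
        (Nat.add_le_add_left (sum_shortCodeLength_le hP hn _) _)
        (Nat.mul_le_mul_right _ (card_long_le hu hmax r))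

end Params

/-- The codes of complete blocks and the low bits together exceed the optimum only by the rounding
in the codes and the loss from cutting off the low bits. -/
theorem sum_codeLength_add_mul_le {y : ℕ → ℕ} {t n m l K : ℕ} (hK : 0 < K)
    (hl : l = 0 ∨ n * K ≤ m / 2 ^ l) (hy : ∑ k ∈ Finset.range (n / t), y k ≤ m / 2 ^ l) :
    ∑ k ∈ Finset.range (n / t), codeLength t (y k) + n * l ≤
      n / t + 2 * (n / K + 1) + B n (m + n) := by
  rw [← Nat.pow_le_pow_iff_right (a := 2) one_lt_two, pow_add, pow_add, pow_add]
  calc 2 ^ (∑ k ∈ Finset.range (n / t), codeLength t (y k)) * 2 ^ (n * l)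
      ≤ 2 ^ (n / t) * (m / 2 ^ l + n).choose n * 2 ^ (n * l) :=
        Nat.mul_le_mul_right _ ((two_pow_sum_codeLength_le t _ _).trans
          (Nat.mul_le_mul_left _ (add_choose_mono hy (Nat.div_mul_le_self n t))))
    _ = 2 ^ (n / t) * ((m / 2 ^ l + n).choose n * 2 ^ (n * l)) := mul_assoc ..
    _ ≤ 2 ^ (n / t) * (2 ^ (2 * (n / K + 1)) * (m + n).choose n) :=
        Nat.mul_le_mul_left _ (choose_div_two_pow_mul_le hK hl)
    _ ≤ 2 ^ (n / t) * (2 ^ (2 * (n / K + 1)) * 2 ^ B n (m + n)) := by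
        gcongr
        exact choose_le_two_pow_B (by lia)
    _ = _ := (mul_assoc ..).symm

theorem Params.lowTotal_add_superOffset_le {P : Params ℕ} {H : ℕ →o ℕ} {m K r : ℕ} (hP : P.Valid)
    (hn : ∀ k ≥ P.count, H k = H P.count) (hm : ∀ k, H k ≤ m) (hmax : 0 < P.maxSum) (hK : 0 < K)
    (hl : P.lowWidth = 0 ∨ P.count * K ≤ m / 2 ^ P.lowWidth) :
    P.lowTotal + P.superOffset (P.high H) r ≤ B P.count (m + P.count) +
      (P.count / P.blockSize + 2 * (P.count / K + 1) + P.codeWidth + r * P.recordsWidth +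
        m / 2 ^ P.lowWidth / P.maxSum * (P.superSize * P.globalWidth)) := by
  have hhigh (k : ℕ) : P.high H k ≤ m / 2 ^ P.lowWidth := Nat.div_le_div_right (hm k)
  have hoffset := superOffset_le hP
    (fun k hk => congrArg (· / 2 ^ P.lowWidth) (hn k hk)) hhigh hmax r
  have hcodes := sum_codeLength_add_mul_le (t := P.blockSize) hK hl
    (sum_sub_le_of_monotone (P.high H).monotone hhigh P.blockSize _)
  simp only [lowTotal, blockSum] at hoffset ⊢
  lia

/-! ### The choice of the parameters -/

/-- The number of binary digits of `n`. -/
def bitLength (n : ℕ) : ℕ := Nat.log 2 n + 1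

/-- An integer version of `lg lg n`. -/
def logLog (n : ℕ) : ℕ := bitLength (bitLength n)

theorem lt_two_pow_bitLength (n : ℕ) : n < 2 ^ bitLength n := Nat.lt_pow_succ_log_self one_lt_two n

theorem logLog_pos (n : ℕ) : 0 < logLog n := Nat.succ_pos _

theorem two_le_two_pow_bitLength (n : ℕ) : 2 ≤ 2 ^ bitLength n :=
  Nat.le_self_pow (Nat.succ_ne_zero _) 2

theorem logLog_le_bitLength (n : ℕ) : logLog n ≤ bitLength n :=
  Nat.log_lt_self 2 (Nat.succ_ne_zero _)

theorem two_pow_logLog_le (n : ℕ) : 2 ^ logLog n ≤ 2 * bitLength n := by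
  have h : 2 ^ Nat.log 2 (bitLength n) ≤ bitLength n := Nat.pow_log_le_self 2 (Nat.succ_ne_zero _)
  rw [logLog, bitLength, pow_succ]
  lia

/-- The number of low bits to be stored separately. It leaves high parts whose average increment is
about `2 ^ logLog n`, unless `m / n` is already smaller. -/
def lowBits (n m : ℕ) : ℕ := Nat.log 2 (m / n / 2 ^ logLog n)

theorem div_two_pow_lowBits_lt {n : ℕ} (m : ℕ) (hn : 0 < n) :
    m / 2 ^ lowBits n m < 2 * n * 2 ^ logLog n := by
  have h : m / (n * 2 ^ logLog n) < 2 ^ (lowBits n m + 1) := by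
    rw [← Nat.div_div_eq_div_mul]
    exact Nat.lt_pow_succ_log_self one_lt_two _
  rw [Nat.div_lt_iff_lt_mul (by positivity)] at h ⊢
  exact h.trans_eq (by ring)

theorem lowBits_eq_zero_or (n m : ℕ) :
    lowBits n m = 0 ∨ n * 2 ^ logLog n ≤ m / 2 ^ lowBits n m := by
  rcases Nat.eq_zero_or_pos (m / n / 2 ^ logLog n) with h | h
  · exact .inl (by rw [lowBits, h, Nat.log_zero_right])
  · have hpow : 2 ^ lowBits n m ≤ m / n / 2 ^ logLog n := Nat.pow_log_le_self 2 h.ne'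
    rw [Nat.div_div_eq_div_mul] at hpow
    refine .inr ((Nat.le_div_iff_mul_le (by positivity)).2 ?_)
    rw [mul_comm]
    exact (Nat.mul_le_mul_right _ hpow).trans (Nat.div_mul_le_self ..)

theorem two_mul_lowBits_le (n m : ℕ) : 2 * (n * lowBits n m) ≤ m := by
  rcases lowBits_eq_zero_or n m with h | h
  · simp [h]
  rw [Nat.le_div_iff_mul_le (by positivity)] at h
  have hlog : 2 ≤ 2 ^ logLog n := Nat.le_self_pow (logLog_pos n).ne' 2
  calc 2 * (n * lowBits n m) = n * 2 * lowBits n m := by ring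
    _ ≤ n * 2 ^ logLog n * 2 ^ lowBits n m := by
        gcongr
        exact Nat.lt_two_pow_self.le
    _ ≤ m := h

/-- The parameters for `n` values of which `l` low bits are stored separately. -/
def params (n l : ℕ) : Params ℕ where
  count := n
  lowWidth := l
  blockSize := logLog n * logLog n
  superBlocks := 2 ^ logLog n
  superCount := n / (logLog n * logLog n * 2 ^ logLog n) + 1
  maxSum := 2 ^ (4 * logLog n)
  codeWidth := logLog n * logLog n * (4 * logLog n + 1)
  localWidth := 8 * logLog n
  globalWidth := 16 * bitLength n

/-- A bound for the number of bits by which the representation exceeds the optimum: the rounding in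
the codes of the blocks, the loss from cutting off the low bits, the code of an incomplete block,
the numbers stored in short superblocks, the data of long superblocks, and the directory, the table
and some slack. The number of low bits has no influence on these widths, and is set to `0`. -/
def redundancy (n : ℕ) : ℕ :=
  let P := params n 0
  n / P.blockSize + 2 * (n / 2 ^ logLog n + 1) + P.codeWidth + P.superCount * P.recordsWidth +
    2 * n * 2 ^ logLog n / P.maxSum * (P.superSize * P.globalWidth) +
    (P.directoryWidth + P.tableWidth + P.superCapacity)

theorem short_superWidth_lt_pow {a p : ℕ} (ha : a ≤ p) (hp : 2 ≤ p) :
    p * 3 * (8 * a) + p * (a * a * (4 * a + 1)) < p ^ 8 :=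
  calc p * 3 * (8 * a) + p * (a * a * (4 * a + 1))
      ≤ p * 3 * (8 * p) + p * (p * p * (4 * p + 1)) := by gcongr
    _ = 6 * (2 ^ 2 * p ^ 2) + p ^ 3 + 4 * p ^ 4 := by ring
    _ ≤ 6 * (p ^ 2 * p ^ 2) + p ^ 4 + 4 * p ^ 4 := by gcongr <;> lia
    _ = 11 * p ^ 4 := by ring
    _ < 2 ^ 4 * p ^ 4 := Nat.mul_lt_mul_of_pos_right (by norm_num) (by positivity)
    _ ≤ p ^ 4 * p ^ 4 := by gcongr
    _ = p ^ 8 := by ring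

theorem superCount_mul_superCapacity_lt_pow {a b r q p : ℕ} (hr : r ≤ p) (ha : a ≤ p) (hb : b ≤ p)
    (hq : q ≤ 2 * p) (hp : 2 ≤ p) :
    r * (q * 3 * (8 * a) + q * (a * a * (4 * a + 1)) + a * a * q * (16 * b)) < p ^ 16 :=
  calc r * (q * 3 * (8 * a) + q * (a * a * (4 * a + 1)) + a * a * q * (16 * b))
      ≤ p * (2 * p * 3 * (8 * p) + 2 * p * (p * p * (4 * p + 1)) + p * p * (2 * p) * (16 * p)) := by
        gcongr
    _ = 48 * p ^ 3 + 2 * p ^ 4 + 40 * p ^ 5 := by ring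
    _ ≤ 48 * p ^ 5 + 2 * p ^ 5 + 40 * p ^ 5 := by gcongr <;> lia
    _ = 90 * p ^ 5 := by ring
    _ < 2 ^ 11 * p ^ 5 := Nat.mul_lt_mul_of_pos_right (by norm_num) (by positivity)
    _ ≤ p ^ 11 * p ^ 5 := by gcongr
    _ = p ^ 16 := by ring

theorem params_valid (n l : ℕ) : (params n l).Valid where
  blockSize_pos := Nat.mul_pos (logLog_pos n) (logLog_pos n)
  superBlocks_pos := Nat.two_pow_pos _
  localWidth_pos := Nat.mul_pos (by norm_num) (logLog_pos n)
  globalWidth_pos := Nat.mul_pos (by norm_num) (Nat.succ_pos _)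
  maxSum_lt := Nat.pow_lt_pow_right one_lt_two
    (Nat.mul_lt_mul_of_pos_right (by norm_num) (logLog_pos n))
  codeLength_le y hy := codeLength_le_mul <| by
    rw [pow_succ, mul_two]
    exact Nat.add_le_add hy Nat.one_le_two_pow
  records_lt := by
    change _ < 2 ^ (8 * logLog n)
    rw [mul_comm 8, pow_mul]
    exact short_superWidth_lt_pow Nat.lt_two_pow_self.le (two_le_two_pow_bitLength _)
  superCount_mul_lt := by
    change _ < 2 ^ (16 * bitLength n)
    rw [mul_comm 16, pow_mul]
    have hlog : bitLength n ≤ 2 ^ bitLength n := Nat.lt_two_pow_self.le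
    exact superCount_mul_superCapacity_lt_pow
      ((Nat.succ_le_succ (Nat.div_le_self ..)).trans (lt_two_pow_bitLength n))
      ((logLog_le_bitLength n).trans hlog) hlog
      ((two_pow_logLog_le n).trans (Nat.mul_le_mul_left 2 hlog)) (two_le_two_pow_bitLength n)

theorem high_lt_two_pow_globalWidth {n m : ℕ} {H : ℕ →o ℕ} (hn : 0 < n) (hm : ∀ k, H k ≤ m)
    (k : ℕ) :
    (params n (lowBits n m)).high H k < 2 ^ (params n (lowBits n m)).globalWidth := by
  have hp := two_le_two_pow_bitLength n
  have hlog : 2 ^ logLog n ≤ 2 * 2 ^ bitLength n :=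
    (two_pow_logLog_le n).trans (Nat.mul_le_mul_left 2 Nat.lt_two_pow_self.le)
  calc H k / 2 ^ lowBits n m ≤ m / 2 ^ lowBits n m := Nat.div_le_div_right (hm k)
    _ < 2 * n * 2 ^ logLog n := div_two_pow_lowBits_lt m hn
    _ ≤ 2 * 2 ^ bitLength n * (2 * 2 ^ bitLength n) := by
        gcongr
        exact (lt_two_pow_bitLength n).le
    _ ≤ 2 ^ bitLength n * 2 ^ bitLength n * (2 ^ bitLength n * 2 ^ bitLength n) := by gcongr
    _ = 2 ^ (4 * bitLength n) := by ring
    _ ≤ 2 ^ (16 * bitLength n) := Nat.pow_le_pow_right two_pos (by lia)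

theorem superBase_add_superOffset_le {n m : ℕ} {H : ℕ →o ℕ} (hn : 0 < n)
    (hlast : ∀ k ≥ n, H k = H n) (hm : ∀ k, H k ≤ m) :
    (params n (lowBits n m)).superBase +
      (params n (lowBits n m)).superOffset ((params n (lowBits n m)).high H)
        (params n (lowBits n m)).superCount ≤ B n (m + n) + redundancy n := by
  set P := params n (lowBits n m)
  have hspace := Params.lowTotal_add_superOffset_le (r := P.superCount) (params_valid n _) hlast hm
    (Nat.two_pow_pos _) (Nat.two_pow_pos (logLog n)) (lowBits_eq_zero_or n m)
  have hlong : m / 2 ^ lowBits n m / P.maxSum * (P.superSize * P.globalWidth) ≤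
      2 * n * 2 ^ logLog n / P.maxSum * (P.superSize * P.globalWidth) :=
    Nat.mul_le_mul_right _ (Nat.div_le_div_right (div_two_pow_lowBits_lt m hn).le)
  have hredundancy : redundancy n =
      n / P.blockSize + 2 * (n / 2 ^ logLog n + 1) + P.codeWidth + P.superCount * P.recordsWidth +
        2 * n * 2 ^ logLog n / P.maxSum * (P.superSize * P.globalWidth) +
        (P.directoryWidth + P.tableWidth + P.superCapacity) := rfl
  have hbase : P.superBase = P.lowTotal + P.directoryWidth + P.tableWidth := rfl
  change P.lowTotal + P.superOffset (P.high H) P.superCount ≤ B n (m + n) +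
    (n / P.blockSize + 2 * (n / 2 ^ logLog n + 1) + P.codeWidth + P.superCount * P.recordsWidth +
      m / 2 ^ lowBits n m / P.maxSum * (P.superSize * P.globalWidth)) at hspace
  lia

theorem params_fits {n m w : ℕ} {H : ℕ →o ℕ} (hn : 0 < n) (hw : 8 ≤ w) (hmn : m + n < 2 ^ w)
    (hred : 4 * redundancy n ≤ 2 ^ w) (hlast : ∀ k ≥ n, H k = H n) (hm : ∀ k, H k ≤ m) :
    (params n (lowBits n m)).Fits w H where
  valid := params_valid n _
  high_lt := high_lt_two_pow_globalWidth hn hm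
  value_lt k := (hm k).trans_lt (by lia)
  eight_le := hw
  count_lt := (Nat.le_add_left n m).trans_lt hmn
  lowTotal_lt := (two_mul_lowBits_le n m).trans_lt (by lia)
  overhead_le := (Nat.mul_le_mul_left 4 (Nat.le_add_left ..)).trans hred
  superOffset_le := by
    have hspace := superBase_add_superOffset_le hn hlast hm
    have hB : B n (m + n) ≤ m + n := (B_le_iff (by lia)).2 (Nat.choose_le_two_pow ..)
    rw [pow_succ]
    lia

/-- The computation of `bitLength n`. -/
def bitLengthExpr (e : Expr) : Expr := e.msb + 1

/-- The computation of `logLog n`. -/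
def logLogExpr : Expr := bitLengthExpr (bitLengthExpr (.inp 0))

/-- The computation of the parameters. -/
def paramsExpr : Params Expr where
  count := .inp 0
  lowWidth := (.inp 1 / .inp 0 / (1 <<< logLogExpr)).msb
  blockSize := logLogExpr * logLogExpr
  superBlocks := 1 <<< logLogExpr
  superCount := .inp 0 / (logLogExpr * logLogExpr * (1 <<< logLogExpr)) + 1
  maxSum := 1 <<< (4 * logLogExpr)
  codeWidth := logLogExpr * logLogExpr * (4 * logLogExpr + 1)
  localWidth := 8 * logLogExpr
  globalWidth := 16 * bitLengthExpr (.inp 0)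

theorem params_lt_two_pow {n l w : ℕ} (hred : 4 * redundancy n ≤ 2 ^ w) :
    (params n l).superCount < 2 ^ w ∧ (params n l).maxSum < 2 ^ w ∧
      (params n l).codeWidth < 2 ^ w ∧ (params n l).localWidth < 2 ^ w ∧
      (params n l).globalWidth < 2 ^ w ∧ (params n l).superSize < 2 ^ w := by
  have hP := params_valid n l
  set P := params n l
  have hoverhead : P.directoryWidth + P.tableWidth + P.superCapacity ≤ redundancy n :=
    Nat.le_add_left ..
  have hpos := Params.superSize_pos hP
  have hsize := Params.superSize_le hP
  have hrows := Params.tableRows_le hP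
  have hmaxSum : P.maxSum + 1 ≤ P.tableRows := by
    rw [Params.tableRows_eq]
    exact Nat.le_mul_of_pos_right _ (by positivity)
  have hcount : P.superCount * 4 ≤ P.directoryWidth := Nat.le_mul_of_pos_right _ hP.globalWidth_pos
  have hglobal : P.globalWidth ≤ P.directoryWidth :=
    Nat.le_mul_of_pos_left _ (Nat.mul_pos (Nat.succ_pos _) (by norm_num))
  have hlocal : P.localWidth ≤ P.recordsWidth :=
    Nat.le_mul_of_pos_left _ (Nat.mul_pos hP.superBlocks_pos (by norm_num))
  have hcode : P.codeWidth ≤ P.superBlocks * P.codeWidth :=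
    Nat.le_mul_of_pos_left _ hP.superBlocks_pos
  have hcapacity : P.superCapacity =
    P.recordsWidth + P.superBlocks * P.codeWidth + P.superSize * P.globalWidth := rfl
  refine ⟨?_, ?_, ?_, ?_, ?_, ?_⟩ <;> lia

theorem bitLengthExpr_hasValue {σ : State} {e : Expr} {k : ℕ} (he : e.HasValue σ k)
    (hw : 8 ≤ σ.wordSize) (hk : bitLength k < 2 ^ σ.wordSize) :
    (bitLengthExpr e).HasValue σ (bitLength k) :=
  he.msb.add (.byte (k := 1) (by norm_num) hw) hk

theorem paramsExpr_hasValues {σ : State} {n m : ℕ} (hn : σ.input 0 = n) (hm : σ.input 1 = m)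
    (hw : 8 ≤ σ.wordSize) (hred : 4 * redundancy n ≤ 2 ^ σ.wordSize) :
    Params.HasValues σ paramsExpr (params n (lowBits n m)) := by
  obtain ⟨hcount, hmaxSum, hcode, hlocal, hglobal, hsize⟩ :=
    params_lt_two_pow (l := lowBits n m) hred
  simp only [params, Params.superSize] at hcount hmaxSum hcode hlocal hglobal hsize
  have hsquare_pos := Nat.mul_pos (logLog_pos n) (logLog_pos n)
  have hsquare := Nat.le_mul_of_pos_right (logLog n * logLog n) (Nat.two_pow_pos (logLog n))
  have hblocks := Nat.le_mul_of_pos_left (2 ^ logLog n) hsquare_pos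
  have byte {k : ℕ} (hk : k < 256) : (Expr.const k).HasValue σ k := .byte hk hw
  have one : (1 : Expr).HasValue σ 1 := byte (by norm_num)
  have pow {e : Expr} {k : ℕ} (he : e.HasValue σ k) (hk : 2 ^ k < 2 ^ σ.wordSize) :
      (1 <<< e).HasValue σ (2 ^ k) := by
    simpa only [one_mul] using one.shiftLeft he (by rwa [one_mul])
  have count : (Expr.inp 0).HasValue σ n := hn
  have length := bitLengthExpr_hasValue count hw (by lia)
  have log : logLogExpr.HasValue σ (logLog n) :=
    bitLengthExpr_hasValue length hw (by rw [← logLog]; lia)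
  have square := log.mul log (by lia)
  have log4 := (byte (k := 4) (by norm_num)).mul log (by lia)
  have blocks := pow log (by lia)
  exact {
    count := count
    lowWidth := ((show (Expr.inp 1).HasValue σ m from hm).div count |>.div blocks).msb
    blockSize := square
    superBlocks := blocks
    superCount := (count.div (square.mul blocks hsize)).add one hcount
    maxSum := pow log4 hmaxSum
    codeWidth := square.mul (log4.add one (by lia)) hcode
    localWidth := (byte (k := 8) (by norm_num)).mul log hlocal
    globalWidth := (byte (k := 16) (by norm_num)).mul length hglobal }

/-! ### The redundancy is of lower order -/

theorem isLittleO_natCast_of_mul_le {f g : ℕ → ℕ} {C : ℕ}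
    (hg : Filter.Tendsto g Filter.atTop Filter.atTop)
    (h : ∀ᶠ n in Filter.atTop, g n * f n ≤ C * n) :
    (fun n => (f n : ℝ)) =o[Filter.atTop] fun n => (n : ℝ) := by
  rw [Asymptotics.isLittleO_iff]
  intro ε hε
  obtain ⟨k, hk⟩ := exists_nat_gt (C / ε)
  filter_upwards [h, hg.eventually_ge_atTop (k + 1)] with n hn hgn
  rw [Real.norm_natCast, Real.norm_natCast]
  have hgn' : (k + 1 : ℝ) ≤ g n := by exact_mod_cast hgn
  have hC : (C : ℝ) ≤ g n * ε := by
    rw [div_lt_iff₀ hε] at hk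
    exact hk.le.trans (by gcongr; linarith)
  refine le_of_mul_le_mul_left (a := (g n : ℝ)) ?_ (hgn'.trans_lt' (by positivity))
  calc (g n : ℝ) * f n ≤ C * n := by exact_mod_cast hn
    _ ≤ g n * ε * n := by gcongr
    _ = g n * (ε * n) := mul_assoc ..

theorem exists_four_mul_le_two_pow {f : ℕ → ℕ}
    (hf : (fun n => (f n : ℝ)) =o[Filter.atTop] fun n => (n : ℝ)) :
    ∃ K ≥ 8, ∀ w > K, ∀ n < 2 ^ w, 4 * f n ≤ 2 ^ w := by
  obtain ⟨N, hN⟩ := Filter.eventually_atTop.1 (hf.bound (show (0 : ℝ) < 1 / 4 by norm_num))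
  refine ⟨8 + ∑ n ∈ Finset.range N, 4 * f n, by lia, fun w hw n hn => ?_⟩
  rcases lt_or_ge n N with h | h
  · have hsum : 4 * f n ≤ ∑ n ∈ Finset.range N, 4 * f n :=
      Finset.single_le_sum (f := fun n => 4 * f n) (fun _ _ => Nat.zero_le _)
        (Finset.mem_range.2 h)
    exact (hsum.trans (by lia)).trans Nat.lt_two_pow_self.le
  · have hfn := hN n h
    rw [Real.norm_natCast, Real.norm_natCast] at hfn
    have hreal : (4 * f n : ℝ) ≤ n := by linarith
    exact (show 4 * f n ≤ n by exact_mod_cast hreal).trans hn.le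

theorem tendsto_bitLength : Filter.Tendsto bitLength Filter.atTop Filter.atTop :=
  Filter.tendsto_atTop_atTop.2 fun b => ⟨2 ^ b, fun _ hn =>
    (Nat.le_log_of_pow_le one_lt_two hn).trans (Nat.le_succ _)⟩

theorem tendsto_logLog : Filter.Tendsto logLog Filter.atTop Filter.atTop :=
  tendsto_bitLength.comp tendsto_bitLength

theorem cube_lt_two_pow {a : ℕ} (ha : 20 ≤ a) : 17 * a ^ 3 < 2 ^ (a - 1) := by
  induction a, ha using Nat.le_induction with
  | base => norm_num
  | succ a ha ih =>
    have hsq : 20 * a ≤ a ^ 2 := by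
      rw [sq]
      gcongr
    have hcube : 20 * a ^ 2 ≤ a ^ 3 := by
      rw [pow_succ a 2, mul_comm]
      gcongr
    calc 17 * (a + 1) ^ 3 = 17 * a ^ 3 + 51 * a ^ 2 + 51 * a + 17 := by ring
      _ < 17 * a ^ 3 * 2 := by lia
      _ ≤ 2 ^ (a - 1) * 2 := Nat.mul_le_mul_right _ ih.le
      _ = 2 ^ (a + 1 - 1) := by rw [← pow_succ, Nat.sub_add_cancel (by lia), Nat.add_sub_cancel]

/-- Codes of about `(logLog n) ^ 3` bits are so short that all of them can be tabulated. -/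
theorem two_pow_codeWidth_le {n : ℕ} (hn : n ≠ 0) (h : 20 ≤ logLog n) :
    (2 ^ logLog n) ^ 12 * 2 ^ (params n 0).codeWidth ≤ n := by
  rw [← pow_mul, ← pow_add]
  have hlog : 2 ^ (logLog n - 1) ≤ bitLength n := Nat.pow_log_le_self 2 (Nat.succ_ne_zero _)
  refine (Nat.pow_le_pow_right two_pos ?_).trans (Nat.pow_log_le_self 2 hn)
  have hone : logLog n ≤ logLog n ^ 3 := Nat.le_self_pow (by lia) _
  have htwo : logLog n ^ 2 ≤ logLog n ^ 3 := Nat.pow_le_pow_right (by lia) (by lia)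
  have hcode : (params n 0).codeWidth = 4 * logLog n ^ 3 + logLog n ^ 2 := by
    simp only [params]
    ring
  have hcube := cube_lt_two_pow h
  rw [bitLength] at hlog
  lia

section

variable {a b p n : ℕ}

theorem mul_rounding_le (a n : ℕ) : a * (n / (a * a)) ≤ n := by
  rcases Nat.eq_zero_or_pos a with rfl | ha
  · simp
  · exact (Nat.mul_le_mul_right _ (Nat.le_mul_of_pos_left a ha)).trans (Nat.mul_div_le n (a * a))

theorem mul_cutoff_le (hap : a ≤ p) (han : a ≤ n) : a * (2 * (n / p + 1)) ≤ 4 * n := by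
  have h := (Nat.mul_le_mul_right _ hap).trans (Nat.mul_div_le n p)
  lia

theorem mul_div_add_one_le {s n : ℕ} (h : s ≤ n) : s * (n / s + 1) ≤ 2 * n := by
  have := Nat.mul_div_le n s
  lia

theorem mul_records_le (h : a * a * p ≤ n) :
    a * ((n / (a * a * p) + 1) * (p * 3 * (8 * a))) ≤ 48 * n :=
  calc a * ((n / (a * a * p) + 1) * (p * 3 * (8 * a)))
      = 24 * (a * a * p * (n / (a * a * p) + 1)) := by ring
    _ ≤ 24 * (2 * n) := Nat.mul_le_mul_left _ (mul_div_add_one_le h)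
    _ = 48 * n := by ring

theorem mul_directory_le (ha : 0 < a) (hbp : b ≤ p) (h : a * a * p ≤ n) :
    a * ((n / (a * a * p) + 1) * 4 * (16 * b)) ≤ 128 * n :=
  calc a * ((n / (a * a * p) + 1) * 4 * (16 * b))
      ≤ a * ((n / (a * a * p) + 1) * 4 * (16 * (a * p))) := by
        gcongr
        exact hbp.trans (Nat.le_mul_of_pos_left _ ha)
    _ = 64 * (a * a * p * (n / (a * a * p) + 1)) := by ring
    _ ≤ 64 * (2 * n) := Nat.mul_le_mul_left _ (mul_div_add_one_le h)
    _ = 128 * n := by ring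

theorem mul_long_le (hap : a ^ 3 ≤ p) (hbp : b ≤ p) (n : ℕ) :
    a * (2 * n * p / p ^ 4 * (a * a * p * (16 * b))) ≤ 32 * n := by
  rcases Nat.eq_zero_or_pos p with rfl | hp
  · simp
  rw [pow_succ, Nat.mul_div_mul_right _ _ hp]
  calc a * (2 * n / p ^ 3 * (a * a * p * (16 * b)))
      = 16 * (2 * n / p ^ 3) * (a ^ 3 * p * b) := by ring
    _ ≤ 16 * (2 * n / p ^ 3) * (p * p * p) := by gcongr
    _ = 16 * (p ^ 3 * (2 * n / p ^ 3)) := by ring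
    _ ≤ 16 * (2 * n) := Nat.mul_le_mul_left _ (Nat.mul_div_le ..)
    _ = 32 * n := by ring

theorem mul_table_le {C : ℕ} (hap : a ≤ p) (hp : 2 ≤ p) :
    a * ((p ^ 4 + 1) * C * (a * a) * (8 * a)) ≤ p ^ 12 * C :=
  calc a * ((p ^ 4 + 1) * C * (a * a) * (8 * a))
      ≤ p * ((p ^ 4 + p ^ 4) * C * (p * p) * (8 * p)) := by
        gcongr
        exact Nat.one_le_pow _ _ (by lia)
    _ = 2 ^ 4 * p ^ 8 * C := by ring
    _ ≤ p ^ 4 * p ^ 8 * C := by gcongr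
    _ = p ^ 12 * C := by ring

theorem mul_codeWidth_le (hap : a ≤ p) (hp : 2 ≤ p) : a * (a * a * (4 * a + 1)) ≤ p ^ 12 :=
  calc a * (a * a * (4 * a + 1)) ≤ p * (p * p * (4 * p + p)) := by gcongr; lia
    _ = 5 * p ^ 4 := by ring
    _ ≤ 2 ^ 8 * p ^ 4 := by gcongr; norm_num
    _ ≤ p ^ 8 * p ^ 4 := by gcongr
    _ = p ^ 12 := by ring

theorem mul_superCapacity_le (hap : a ≤ p) (hbp : b ≤ p) (hp : 2 ≤ p) :
    a * (p * 3 * (8 * a) + p * (a * a * (4 * a + 1)) + a * a * p * (16 * b)) ≤ p ^ 12 :=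
  calc a * (p * 3 * (8 * a) + p * (a * a * (4 * a + 1)) + a * a * p * (16 * b))
      ≤ p * (p * 3 * (8 * p) + p * (p * p * (4 * p + p)) + p * p * p * (16 * p)) := by
        gcongr
        lia
    _ = 24 * p ^ 3 + 21 * p ^ 5 := by ring
    _ ≤ 24 * p ^ 5 + 21 * p ^ 5 := by gcongr <;> lia
    _ = 45 * p ^ 5 := by ring
    _ ≤ 2 ^ 7 * p ^ 5 := by gcongr; norm_num
    _ ≤ p ^ 7 * p ^ 5 := by gcongr
    _ = p ^ 12 := by ring

end

theorem logLog_mul_redundancy_le {n : ℕ} (hn : n ≠ 0) (h : 20 ≤ logLog n) :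
    logLog n * redundancy n ≤ 220 * n := by
  have hlarge := two_pow_codeWidth_le hn h
  have hC : 0 < 2 ^ (params n 0).codeWidth := by positivity
  have hcube : logLog n ^ 3 ≤ 2 ^ logLog n := by
    have := cube_lt_two_pow h
    have : 2 ^ (logLog n - 1) ≤ 2 ^ logLog n := Nat.pow_le_pow_right two_pos (by lia)
    lia
  have hap : logLog n ≤ 2 ^ logLog n := Nat.lt_two_pow_self.le
  have hbp : bitLength n ≤ 2 ^ logLog n := (lt_two_pow_bitLength _).le
  have hp : 2 ≤ 2 ^ logLog n := two_le_two_pow_bitLength _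
  simp only [redundancy, Params.directoryWidth, Params.tableWidth, Params.superCapacity,
    Params.recordsWidth, Params.superSize, Params.tableRows_eq, params,
    show 2 ^ (4 * logLog n) = (2 ^ logLog n) ^ 4 from pow_mul' ..] at hlarge hC ⊢
  generalize 2 ^ (logLog n * logLog n * (4 * logLog n + 1)) = C at hlarge hC ⊢
  have hpn : (2 ^ logLog n) ^ 12 ≤ n := (Nat.le_mul_of_pos_right _ hC).trans hlarge
  have hsize : logLog n * logLog n * 2 ^ logLog n ≤ n := by
    refine le_trans ?_ hpn
    calc _ ≤ 2 ^ logLog n * 2 ^ logLog n * 2 ^ logLog n := by gcongr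
      _ = (2 ^ logLog n) ^ 3 := by ring
      _ ≤ _ := Nat.pow_le_pow_right (by lia) (by norm_num)
  have han : logLog n ≤ n := hap.trans ((Nat.le_self_pow (by norm_num) _).trans hpn)
  have := mul_rounding_le (logLog n) n
  have := mul_cutoff_le hap han
  have := mul_codeWidth_le hap hp
  have := mul_records_le hsize
  have := mul_long_le hcube hbp n
  have := mul_directory_le (logLog_pos n) hbp hsize
  have := mul_table_le (C := C) hap hp
  have := mul_superCapacity_le hap hbp hp
  simp only [mul_add] at *
  lia

theorem redundancy_isLittleO :
    (fun n => (redundancy n : ℝ)) =o[Filter.atTop] fun n => (n : ℝ) :=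
  isLittleO_natCast_of_mul_le (C := 220) tendsto_logLog <| by
    filter_upwards [Filter.eventually_ne_atTop 0, tendsto_logLog.eventually_ge_atTop 20]
      with n hn h using logLog_mul_redundancy_le hn h

/-! ### Monotone sequences -/

/-- An expression for `1` in words of more than `K` bits. In shorter words `2 ^ K` overflows to `0`,
and the value is `0 / 0 = 0`. -/
def Expr.bigWord (K : ℕ) : Expr := const (2 ^ K) / const (2 ^ K)

/-- The query program. Words of at most `K` bits store one value each, because only for longer words
has the compressed representation been shown to fit. -/
def Expr.query (K : ℕ) : Expr :=
  select (bigWord K) paramsExpr.answer Params.index.load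

section

variable {K n m w S : ℕ} {H : ℕ →o ℕ}

theorem exists_bits_of_wordSize_le (hw : w ≤ K) (hmn : m + n < 2 ^ w) (hm : ∀ k, H k ≤ m)
    (hS : K * 2 ^ K ≤ S) :
    ∃ bits : BitVec S, ∀ i < n,
      (Expr.query K).HasValue (queryState n m w bits (i + 1)) (H (i + 1)) := by
  have hvalue (k : ℕ) : H k < 2 ^ w := (hm k).trans_lt (by lia)
  have hlength : n * w ≤ K * 2 ^ K := by
    rw [mul_comm]
    exact Nat.mul_le_mul hw (le_of_lt (by have := Nat.pow_le_pow_right two_pos hw; lia))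
  refine ⟨BitVec.ofNatLT (packArray w (fun k => H (k + 1)) n)
    ((packArray_lt fun k _ => hvalue _).trans_le (Nat.pow_le_pow_right two_pos (hlength.trans hS))),
    fun i hi => ?_⟩
  set σ := queryState n m w _ (i + 1)
  have hw0 : 0 < σ.wordSize := by
    by_contra h
    rw [show w = 0 from Nat.eq_zero_of_not_pos h] at hmn
    lia
  have hmem : σ.mem i = H (i + 1) := bitField_packArray (fun k _ => hvalue _) hi
  have hbig : (Expr.bigWord K).HasValue σ 0 := by
    have hpow : (Expr.const (2 ^ K)).HasValue σ 0 :=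
      Nat.mod_eq_zero_of_dvd (Nat.pow_dvd_pow 2 hw)
    exact hpow.div hpow
  have hindex : Params.index.HasValue σ i :=
    .sub (show (Expr.inp 3).HasValue σ (i + 1) from rfl) (.const (Nat.one_lt_two_pow hw0.ne'))
      (Nat.le_add_left 1 i) (show i + 1 < 2 ^ w by lia)
  exact hbig.select_zero (hmem ▸ hindex.load) hw0 (hvalue _)

theorem exists_bits_of_lt_wordSize (h8 : 8 ≤ K) (hw : K < w) (hn : 0 < n) (hmn : m + n < 2 ^ w)
    (hred : 4 * redundancy n ≤ 2 ^ w) (hlast : ∀ k ≥ n, H k = H n) (hm : ∀ k, H k ≤ m)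
    (hS : B n (m + n) + redundancy n ≤ S) :
    ∃ bits : BitVec S, ∀ i < n,
      (Expr.query K).HasValue (queryState n m w bits (i + 1)) (H (i + 1)) := by
  have hfits := params_fits hn (h8.trans hw.le) hmn hred hlast hm
  refine ⟨BitVec.ofNatLT ((params n (lowBits n m)).encode w H)
    ((Params.encode_lt hfits.valid hfits.high_lt).trans_le
      (Nat.pow_le_pow_right two_pos ((superBase_add_superOffset_le hn hlast hm).trans hS))),
    fun i hi => ?_⟩
  set σ := queryState n m w _ (i + 1)
  have hqueries : Params.Queries σ paramsExpr (params n (lowBits n m)) H i :=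
    { hfits with
      values := paramsExpr_hasValues rfl rfl (h8.trans hw.le) hred
      holds := queryState_holds ..
      input_three := rfl
      index_lt := hi
      superIndex_lt := Nat.lt_succ_of_le (Nat.div_le_div_right hi.le) }
  have hbig : (Expr.bigWord K).HasValue σ 1 := by
    have hpow : (Expr.const (2 ^ K)).HasValue σ (2 ^ K) :=
      .const (Nat.pow_lt_pow_right one_lt_two hw)
    rw [← Nat.div_self (Nat.two_pow_pos K)]
    exact hpow.div hpow
  exact hbig.select_one hqueries.answer_hasValue (Nat.zero_lt_of_lt hw) (hfits.value_lt _)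

end

theorem exists_program_of_monotone :
    ∃ (P : Program) (T : ℕ) (g : ℕ → ℕ),
      (fun n => (g n : ℝ)) =o[Filter.atTop] (fun n => (n : ℝ)) ∧
      ∀ n m w : ℕ, m + n < 2 ^ w → ∀ H : ℕ →o ℕ, (∀ k ≥ n, H k = H n) → (∀ k, H k ≤ m) →
        ∃ bits : BitVec (B n (m + n) + g n), ∀ i, 1 ≤ i → i ≤ n →
          Answers P T n m w bits i (H i) := by
  obtain ⟨K, h8, hK⟩ := exists_four_mul_le_two_pow redundancy_isLittleO
  refine ⟨(Expr.query K).program, (Expr.query K).program.length,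
    fun n => redundancy n + K * 2 ^ K, ?_, fun n m w hmn H hlast hm => ?_⟩
  · simp only [Nat.cast_add]
    exact redundancy_isLittleO.add
      (Asymptotics.isLittleO_const_left.2 (.inr (tendsto_norm_atTop_atTop.comp
        tendsto_natCast_atTop_atTop)))
  obtain ⟨bits, hbits⟩ : ∃ bits : BitVec (B n (m + n) + (redundancy n + K * 2 ^ K)), ∀ i < n,
      (Expr.query K).HasValue (queryState n m w bits (i + 1)) (H (i + 1)) := by
    rcases Nat.eq_zero_or_pos n with rfl | hn
    · exact ⟨0, fun i hi => absurd hi (Nat.not_lt_zero i)⟩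
    rcases Nat.lt_or_ge K w with hw | hw
    · exact exists_bits_of_lt_wordSize h8 hw hn hmn (hK w hw n (by lia)) hlast hm (by lia)
    · exact exists_bits_of_wordSize_le hw hmn hm (by lia)
  refine ⟨bits, fun i hi hin => ?_⟩
  obtain ⟨i, rfl⟩ := Nat.exists_eq_add_of_le' hi
  have hvalue := hbits i hin
  rw [Expr.HasValue] at hvalue
  exact hvalue ▸ Expr.program_answers ..

theorem prefixSum_of_le {n i : ℕ} (x : Fin n → ℕ) (h : n ≤ i) : prefixSum x i = ∑ j, x j := by
  rw [prefixSum, Finset.filter_true_of_mem fun j _ => j.isLt.trans_le h]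

theorem exists_orderHom_prefixSum {n m : ℕ} {x : Fin n → ℕ} (hx : ∑ j, x j ≤ m) :
    ∃ H : ℕ →o ℕ, (∀ k ≥ n, H k = H n) ∧ (∀ k, H k ≤ m) ∧ ∀ i, H i = prefixSum x i :=
  ⟨⟨prefixSum x, prefixSum_mono x⟩,
    fun _ hk => (prefixSum_of_le x hk).trans (prefixSum_of_le x le_rfl).symm,
    fun k => (prefixSum_le_sum x k).trans hx, fun _ => rfl⟩

/-! ### Multisets -/

section

variable {m n : ℕ} {h : Fin n → Fin m}

theorem rankm_map {x : Fin m} (hx : x ∈ Finset.univ.val.map h) :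
    rankm x (Finset.univ.val.map h) = (Finset.univ.filter fun k => h k < x).card := by
  rw [rankm, if_pos hx, Multiset.countP_map]
  rfl

theorem isSelectm_map (hh : Monotone h) (j : Fin n) :
    IsSelectm (j + 1) (Finset.univ.val.map h) (h j) := by
  have hmem : h j ∈ Finset.univ.val.map h := Multiset.mem_map_of_mem _ (Finset.mem_univ_val j)
  refine ⟨⟨hmem, ?_⟩, fun x ⟨hx, hr⟩ => ?_⟩
  · have hcard := Finset.card_le_card (show Finset.univ.filter (h · < h j) ⊆ Finset.Iio j from
      fun k hk => Finset.mem_Iio.2 (hh.reflect_lt (Finset.mem_filter.1 hk).2))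
    rw [Fin.card_Iio] at hcard
    rw [rankm_map hmem]
    lia
  · by_contra! hlt
    have hcard := Finset.card_le_card (show Finset.Iic j ⊆ Finset.univ.filter (h · < x) from
      fun k hk => Finset.mem_filter.2 ⟨Finset.mem_univ k, (hh (Finset.mem_Iic.1 hk)).trans_lt hlt⟩)
    rw [Fin.card_Iic] at hcard
    rw [rankm_map hx, Nat.cast_add, Nat.cast_one, add_sub_cancel_right] at hr
    exact absurd (Nat.cast_le.1 hr) (Nat.not_le_of_lt hcard)

theorem exists_monotone_map_eq (M : Multiset (Fin m)) (hM : M.card = n) :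
    ∃ h : Fin n → Fin m, Monotone h ∧ Finset.univ.val.map h = M := by
  subst hM
  have hlength : (M.sort (· ≤ ·)).length = M.card := Multiset.length_sort _
  refine ⟨fun j => (M.sort (· ≤ ·)).get (j.cast hlength.symm), fun a b hab => ?_, ?_⟩
  · exact (Multiset.pairwise_sort M (· ≤ ·)).sortedLE.monotone_get hab
  · rw [Fin.univ_val_map]
    conv_rhs => rw [← Multiset.sort_eq M (· ≤ ·)]
    exact congrArg _ (List.ext_get (by simp) fun k _ _ => by simp)

theorem exists_orderHom_isSelectm {M : Multiset (Fin m)} (hM : M.card = n) :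
    ∃ H : ℕ →o ℕ, (∀ k ≥ n, H k = H n) ∧ (∀ k, H k ≤ m) ∧
      ∀ i, 1 ≤ i → i ≤ n → ∃ v : Fin m, IsSelectm i M v ∧ H i = v := by
  obtain ⟨h, hh, rfl⟩ := exists_monotone_map_eq M hM
  rcases Nat.eq_zero_or_pos n with rfl | hn
  · exact ⟨⊥, fun _ _ => rfl, fun _ => Nat.zero_le _, by lia⟩
  refine ⟨⟨fun k => h ⟨min (k - 1) (n - 1), by lia⟩, fun a b hab => hh (Fin.mk_le_mk.2 (by lia))⟩,
    fun k hk => ?_, fun k => (Fin.isLt _).le, fun i hi hin => ?_⟩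
  · exact congrArg (fun j => (h j : ℕ)) (Fin.ext (show min _ _ = min _ _ by lia))
  · have hselect := isSelectm_map hh ⟨i - 1, by lia⟩
    rw [Fin.val_mk, Nat.sub_add_cancel hi] at hselect
    exact ⟨_, hselect, congrArg (fun j => (h j : ℕ)) (Fin.ext (min_eq_left (by lia)))⟩

end

end Succinct

open Succinct in
theorem mainTheorem7 :
    -- prefix sums
    (∃ (P : Program) (T : ℕ) (g : ℕ → ℝ),
      g =o[Filter.atTop] (fun n : ℕ => (n : ℝ)) ∧
      ∀ n m w : ℕ, m + n < 2 ^ w →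
        ∃ S : ℕ, (S : ℝ) ≤ B n (m + n) + g n ∧
          ∀ x : Fin n → ℕ, ∑ j, x j ≤ m →
            ∃ bits : BitVec S, ∀ i : ℕ, 1 ≤ i → i ≤ n →
              Answers P T n m w bits i (prefixSum x i)) ∧
    -- multisets with select
    (∃ (P : Program) (T : ℕ) (g : ℕ → ℝ),
      g =o[Filter.atTop] (fun n : ℕ => (n : ℝ)) ∧
      ∀ n m w : ℕ, m + n < 2 ^ w →
        ∃ S : ℕ, (S : ℝ) ≤ B n (m + n) + g n ∧
          ∀ M : Multiset (Fin m), M.card = n →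
            ∃ bits : BitVec S, ∀ i : ℕ, 1 ≤ i → i ≤ n →
              ∃ v : Fin m, IsSelectm i M v ∧ Answers P T n m w bits i v) ∧
    -- optimality
    (∀ n m : ℕ,
      IsLeast {L : ℕ | EncodableInBits {x : Fin n → ℕ // ∑ j, x j ≤ m} L} (B n (m + n)) ∧
      (∀ L : ℕ, EncodableInBits {x : Fin n → ℕ // ∑ j, x j = m} L →
        B n (m + n) ≤ L + ⌈Real.logb 2 (((m : ℝ) + n) / n)⌉₊) ∧
      (∀ L : ℕ, EncodableInBits {M : Multiset (Fin m) // M.card = n} L →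
        B n (m + n) ≤ L + ⌈Real.logb 2 ((n : ℝ) + 1)⌉₊)) := by
  obtain ⟨P, T, g, hg, hP⟩ := exists_program_of_monotone
  refine ⟨⟨P, T, fun n => g n, hg, fun n m w hmn => ⟨B n (m + n) + g n, by simp, fun x hx => ?_⟩⟩,
    ⟨P, T, fun n => g n, hg, fun n m w hmn => ⟨B n (m + n) + g n, by simp, fun M hM => ?_⟩⟩,
    fun n m => ⟨isLeast_encodable_bounded_sum n m, fun _ => B_le_of_encodable_exact_sum,
      fun _ => B_le_of_encodable_multiset⟩⟩
  · obtain ⟨H, hlast, hm, hH⟩ := exists_orderHom_prefixSum hx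
    obtain ⟨bits, hbits⟩ := hP n m w hmn H hlast hm
    exact ⟨bits, fun i hi hin => hH i ▸ hbits i hi hin⟩
  · obtain ⟨H, hlast, hm, hH⟩ := exists_orderHom_isSelectm hM
    obtain ⟨bits, hbits⟩ := hP n m w hmn H hlast hm
    refine ⟨bits, fun i hi hin => ?_⟩
    obtain ⟨v, hv, hHv⟩ := hH i hi hin
    exact ⟨v, hv, hHv ▸ hbits i hi hin⟩
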